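/- Let $X=(X_1,\dots,X_K)$ be a random vector in $\mathbb R^K$, let $h:\mathbb R^K\to\mathbb R$ be measurable with $E[h(X)^2]<\infty$, and let $\tau=E[h(X)]$. For $k=1,\dots,K$ let $F_k(\cdot\mid x_1,\dots,x_{k-1})$ be a version of the conditional distribution function of $X_k$ given $X_1=x_1,\dots,X_{k-1}=x_{k-1}$, and let $F_k^{-1}(y\mid x_1,\dots,x_{k-1})=\inf\{x: F_k(x\mid x_1,\dots,x_{k-1})\ge y\}$ be its quantile function. For $z\in[0,1]^K$ let $x=\mathbf m^{-1}(z)$ be computed sequentially by $x_k=F_k^{-1}(z_k\mid x_1,\dots,x_{k-1})$, $k=1,\dots,K$; this inverts the transform $\mathbf m$ given by $z_k=F_k(x_k\mid x_1,\dots,x_{k-1})$. Put $h^*=h\circ\mathbf m^{-1}$ and, for $z\in[0,1]^K$, $$\alpha_k(z_k)=\int_{[0,1]^{K-1}}\bigl(h^*(z)-\tau\bigr)\,dz_{-k},\qquad r(z)=h^*(z)-\tau-\sum_{k=1}^K\alpha_k(z_k),$$ where $z_{-k}$ is $z$ without its $k$-th coordinate. For $N\ge1$ let $(p_{1k},\dots,p_{Nk})$,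 $k=1,\dots,K$, be independent uniformly distributed random permutations of $\{1,\dots,N\}$ and, independently of them, let $u_{jk}$ ($1\le j\le N$, $1\le k\le K$) be i.i.d. uniform on $[0,1]$. Put $z_{jk}=(p_{jk}-u_{jk})/N$ and $\mathbf X_j=\mathbf m^{-1}(z_{j1},\dots,z_{jK})$. The points $\mathbf X_1,\dots,\mathbf X_N$ are the Latin hypercube sample for dependent inputs (LHSD), and $\hat\tau=N^{-1}\sum_{j=1}^N h(\mathbf X_j)$. Then $h^*$, $r$, the $\alpha_k$ and $\hat\tau$ are square integrable and, as $N\to\infty$, $$\operatorname{Var}_{\mathrm{LHSD}}(\hat\tau)=\frac1N\int_{[0,1]^K} r(z)^2\,dz+o\Bigl(\frac1N\Bigr).$$ Consequently, with $\operatorname{Var}_{\mathrm{SRS}}(\hat\tau)$ the variance of the same estimator computed from $N$ independent copies of $X$ (simple random sampling), $$\operatorname{Var}_{\mathrm{SRS}}(\hat\tau)-\operatorname{Var}_{\mathrm{LHSD}}(\hat\tau)=\frac1N\sum_{k=1}^K\int_0^1\alpha_k(t)^2\,dt+o\Bigl(\frac1N\Bigr).$$ -/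

import Mathlib

open MeasureTheory ProbabilityTheory Set Filter Asymptotics

noncomputable section

namespace LHSD

/-! ### The sequential conditional-CDF transform

`Q k` is a conditional distribution of the `k`-th input given the inputs with smaller index: for
`w : Fin k → ℝ` the conditional distribution function is `x ↦ cdf (Q k w) x = (Q k w).real (Iic x)`.
-/

/-- The first `k` coordinates of `x`. -/
def prefixOf {K : ℕ} (x : Fin K → ℝ) (k : Fin K) : Fin (k : ℕ) → ℝ :=
  fun i => x ⟨i, i.2.trans k.2⟩

/-- The quantile function `y ↦ inf {x | F x ≥ y}` of the distribution function `F` of `μ`. -/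
def quantile (μ : Measure ℝ) (y : ℝ) : ℝ :=
  sInf {x : ℝ | y ≤ cdf μ x}

/-- `z = m(x)`, that is `z k = F_k (x k | x 0, …, x (k-1))`. -/
def rosenblatt {K : ℕ} (Q : (k : Fin K) → Kernel (Fin (k : ℕ) → ℝ) ℝ) (x : Fin K → ℝ) :
    Fin K → ℝ :=
  fun k => cdf (Q k (prefixOf x k)) (x k)

/-- `x = m⁻¹(z)`, computed sequentially: `x k = F_k⁻¹ (z k | x 0, …, x (k-1))`, with the inverse of
each conditional distribution function understood as the quantile function. -/
def invRosenblatt {K : ℕ} (Q : (k : Fin K) → Kernel (Fin (k : ℕ) → ℝ) ℝ) (z : Fin K → ℝ) :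
    Fin K → ℝ
  | k => quantile (Q k (fun i : Fin (k : ℕ) => invRosenblatt Q z ⟨i, i.2.trans k.2⟩)) (z k)
termination_by k => (k : ℕ)
decreasing_by exact i.2

lemma invRosenblatt_apply {K : ℕ} (Q : (k : Fin K) → Kernel (Fin (k : ℕ) → ℝ) ℝ)
    (z : Fin K → ℝ) (k : Fin K) :
    invRosenblatt Q z k = quantile (Q k (prefixOf (invRosenblatt Q z) k)) (z k) := by
  rw [invRosenblatt]
  rfl

lemma cdf_quantile {μ : Measure ℝ} (hc : Continuous (cdf μ)) {y : ℝ} (h0 : 0 < y) (h1 : y < 1) :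
    cdf μ (quantile μ y) = y := by
  have hne : {x : ℝ | y ≤ cdf μ x}.Nonempty := by
    obtain ⟨x, hx⟩ := ((tendsto_cdf_atTop μ).eventually (lt_mem_nhds h1)).exists
    exact ⟨x, hx.le⟩
  have hb : BddBelow {x : ℝ | y ≤ cdf μ x} := by
    obtain ⟨b, hb⟩ := ((tendsto_cdf_atBot μ).eventually (gt_mem_nhds h0)).exists
    refine ⟨b, fun x hx => ?_⟩
    by_contra hlt
    exact absurd (hx.trans (monotone_cdf μ (not_le.1 hlt).le)) (not_le.2 hb)
  refine le_antisymm ?_ ((isClosed_le continuous_const hc).csInf_mem hne hb)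
  refine le_of_tendsto (hc.continuousAt.tendsto.mono_left
    (nhdsWithin_le_nhds : nhdsWithin (quantile μ y) (Iio (quantile μ y)) ≤ _)) ?_
  filter_upwards [self_mem_nhdsWithin] with x hx
  exact (not_le.1 fun h => notMem_of_lt_csInf hx hb h).le

/-- For continuous conditional distribution functions, `invRosenblatt` is a right inverse of
`rosenblatt` on the open unit cube. -/
lemma rosenblatt_invRosenblatt {K : ℕ} (Q : (k : Fin K) → Kernel (Fin (k : ℕ) → ℝ) ℝ)
    (hc : ∀ k w, Continuous (cdf (Q k w))) {z : Fin K → ℝ} (hz : ∀ k, z k ∈ Ioo (0 : ℝ) 1) :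
    rosenblatt Q (invRosenblatt Q z) = z := by
  funext k
  rw [rosenblatt, invRosenblatt_apply]
  exact cdf_quantile (hc _ _) (hz k).1 (hz k).2

/-- `h* = h ∘ m⁻¹`. -/
def hStar {K : ℕ} (Q : (k : Fin K) → Kernel (Fin (k : ℕ) → ℝ) ℝ) (h : (Fin K → ℝ) → ℝ) :
    (Fin K → ℝ) → ℝ :=
  fun z => h (invRosenblatt Q z)

/-! ### Decomposition into main effects and residual -/

/-- Lebesgue measure on the unit cube with coordinates in `ι`. -/
def cube (ι : Type) [Fintype ι] : Measure (ι → ℝ) :=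
  (volume : Measure (ι → ℝ)).restrict (Icc 0 1)

/-- The main effect `α_k(t) = ∫ (g z - τ) dz_{-k}`: the `k`-th coordinate is `t` and all the other
coordinates are integrated over the unit interval. -/
def mainEffect {K : ℕ} (g : (Fin K → ℝ) → ℝ) (τ : ℝ) (k : Fin K) (t : ℝ) : ℝ :=
  ∫ y : {j : Fin K // j ≠ k} → ℝ,
    (g (fun j => if hj : j = k then t else y ⟨j, hj⟩) - τ) ∂(cube {j : Fin K // j ≠ k})

/-- The residual from additivity `r z = g z - τ - ∑ k, α_k (z k)`. -/
def residual {K : ℕ} (g : (Fin K → ℝ) → ℝ) (τ : ℝ) (z : Fin K → ℝ) : ℝ :=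
  g z - τ - ∑ k : Fin K, mainEffect g τ k (z k)

/-! ### Latin hypercube sampling -/

/-- Every set of permutations is measurable. -/
instance permMeasurableSpace (N : ℕ) : MeasurableSpace (Equiv.Perm (Fin N)) := ⊤

/-- The randomness of Latin hypercube sampling: `K` independent uniform permutations of
`{0, …, N-1}` and, independently of them, an `N × K` matrix of i.i.d. uniform variables
on `[0,1]`. -/
def lhsMeasure (N K : ℕ) :
    Measure ((Fin K → Equiv.Perm (Fin N)) × (Fin N → Fin K → ℝ)) :=
  (Measure.pi fun _ : Fin K => (PMF.uniformOfFintype (Equiv.Perm (Fin N))).toMeasure).prod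
    (Measure.pi fun _ : Fin N =>
      Measure.pi fun _ : Fin K => (volume : Measure ℝ).restrict (Icc 0 1))

/-- The `j`-th point of the Latin hypercube sample, `z_{jk} = (p_{jk} - u_{jk}) / N`, where
`p_{jk} ∈ {1, …, N}` is one plus the value of the `k`-th permutation at `j`. -/
def lhsPoint {N K : ℕ} (ω : (Fin K → Equiv.Perm (Fin N)) × (Fin N → Fin K → ℝ)) (j : Fin N) :
    Fin K → ℝ :=
  fun k => ((((ω.1 k j : Fin N) : ℕ) : ℝ) + 1 - ω.2 j k) / (N : ℝ)

/-- The `j`-th point `x_j = m⁻¹(z_j)` of the Latin hypercube sample for dependent inputs. -/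
def lhsdPoint {N K : ℕ} (Q : (k : Fin K) → Kernel (Fin (k : ℕ) → ℝ) ℝ)
    (ω : (Fin K → Equiv.Perm (Fin N)) × (Fin N → Fin K → ℝ)) (j : Fin N) : Fin K → ℝ :=
  invRosenblatt Q (lhsPoint ω j)

/-- The sample mean `N⁻¹ ∑ j, h (x j)`. -/
def sampleMean {N K : ℕ} (h : (Fin K → ℝ) → ℝ) (x : Fin N → Fin K → ℝ) : ℝ :=
  (∑ j : Fin N, h (x j)) / (N : ℝ)

/-- The estimator computed from a Latin hypercube sample of size `N` for dependent inputs. -/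
def lhsdEstimator {K : ℕ} (Q : (k : Fin K) → Kernel (Fin (k : ℕ) → ℝ) ℝ) (h : (Fin K → ℝ) → ℝ)
    (N : ℕ) (ω : (Fin K → Equiv.Perm (Fin N)) × (Fin N → Fin K → ℝ)) : ℝ :=
  sampleMean h (lhsdPoint Q ω)

/-- The law of a simple random sample of size `N`: `N` independent draws from `μ`. -/
def srsMeasure {K : ℕ} (μ : Measure (Fin K → ℝ)) (N : ℕ) : Measure (Fin N → Fin K → ℝ) :=
  Measure.pi fun _ : Fin N => μ

end LHSD

end

noncomputable section

namespace LHSD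

/-! Sequential quantile transforms carry the uniform law on the cube to the law of `X`
(`hasLaw_invRosenblatt`). LHSD is thus ordinary Latin hypercube sampling of the centred function `f
= h* - τ` of independent uniform coordinates.

Each sample point is uniform on the cube, so `N * Var = ∫ f² + (N - 1) * E[f(z_i) f(z_j)]` for any
`i ≠ j`. In each coordinate the cells of two points form a uniformly chosen ordered pair of distinct
cells, independently over coordinates. Relative to independent points the pair therefore has density
`∏ k, N / (N - 1) * (1 - 1{same k-th cell})`. Expanding this product over subsets `S` of coordinates
gives the alternating sum of `pairSum f N S` (`integral_lhsPoint_mul_lhsPoint`).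

The empty set contributes `(∫ f)² = 0`. For `S = {k}`, `N * pairSum` is the squared norm of the
projection of `α_k` onto step functions on the grid and tends to `∫ α_k²`
(`tendsto_sum_sq_integral_cell`). For `|S| ≥ 2` the term is `O(N^{-|S|})` (`abs_pairSum_le`). Hence
`N * Var → ∫ f² - ∑ ∫ α_k²`, which is `∫ r²` because the main effects are the orthogonal projection
of `f` onto additive functions (`integral_sq_sub_sum_margin`). -/

/-- The uniform distribution on the unit interval. -/
abbrev unif : Measure ℝ := (volume : Measure ℝ).restrict (Icc 0 1)

instance : IsProbabilityMeasure unif := ⟨by simp⟩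

lemma ae_unif_mem_Ioo : ∀ᵐ t ∂unif, t ∈ Ioo (0 : ℝ) 1 := by
  rw [unif, restrict_Ioo_eq_restrict_Icc.symm]
  exact ae_restrict_mem measurableSet_Ioo

lemma cube_eq_pi (ι : Type) [Fintype ι] : cube ι = Measure.pi fun _ : ι => unif := by
  rw [cube, ← pi_univ_Icc, volume_pi, Measure.restrict_pi_pi]
  rfl

instance (ι : Type) [Fintype ι] : IsProbabilityMeasure (cube ι) := by
  rw [cube_eq_pi]; infer_instance

/-! ### The quantile transform -/

/-- Right continuity of the distribution function makes the infimum attained. The endpoints are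
excluded because the set may be unbounded below at `y = 0` and empty at `y = 1`, where `sInf` takes
a default value. -/
lemma quantile_le_iff (μ : Measure ℝ) [IsProbabilityMeasure μ] {y : ℝ} (hy : y ∈ Ioo (0 : ℝ) 1)
    (x : ℝ) : quantile μ y ≤ x ↔ y ≤ cdf μ x := by
  have hne : {x : ℝ | y ≤ cdf μ x}.Nonempty := by
    obtain ⟨x, hx⟩ := ((tendsto_cdf_atTop μ).eventually (lt_mem_nhds hy.2)).exists
    exact ⟨x, hx.le⟩
  have hb : BddBelow {x : ℝ | y ≤ cdf μ x} := by
    obtain ⟨b, hb⟩ := ((tendsto_cdf_atBot μ).eventually (gt_mem_nhds hy.1)).exists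
    refine ⟨b, fun x hx => ?_⟩
    by_contra hlt
    exact absurd (hx.trans (monotone_cdf μ (not_le.1 hlt).le)) (not_le.2 hb)
  refine ⟨fun h => ?_, fun h => csInf_le hb h⟩
  have hrc : Tendsto (cdf μ) (nhdsWithin x (Ioi x)) (nhds (cdf μ x)) :=
    ((cdf μ).right_continuous x).tendsto.mono_left (nhdsWithin_mono _ Ioi_subset_Ici_self)
  refine ge_of_tendsto hrc ?_
  filter_upwards [self_mem_nhdsWithin] with x' hx'
  obtain ⟨a, ha, hax⟩ := exists_lt_of_csInf_lt hne (lt_of_le_of_lt h hx')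
  exact le_trans ha (monotone_cdf μ hax.le)

/-- The quantile function of a kernel, set to zero outside the open unit interval. -/
def kernelQuantile {𝓧 : Type*} [MeasurableSpace 𝓧] (κ : Kernel 𝓧 ℝ) (p : 𝓧 × ℝ) : ℝ :=
  open Classical in if p.2 ∈ Ioo (0 : ℝ) 1 then quantile (κ p.1) p.2 else 0

/-- The cutoff outside `(0,1)` changes only a null set and removes the default values of `sInf`;
inside, the sublevel sets are `{y ≤ cdf (κ w) x}`, jointly measurable in `(w, y)`. -/
lemma measurable_kernelQuantile {𝓧 : Type*} [MeasurableSpace 𝓧] (κ : Kernel 𝓧 ℝ)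
    [IsMarkovKernel κ] : Measurable (kernelQuantile κ) := by
  refine measurable_of_Iic fun x => ?_
  have hS : MeasurableSet {p : 𝓧 × ℝ | p.2 ∈ Ioo (0 : ℝ) 1} := measurable_snd measurableSet_Ioo
  have hm : Measurable fun p : 𝓧 × ℝ => cdf (κ p.1) x := by
    simp only [cdf_eq_real, measureReal_def]
    exact ((κ.measurable_coe measurableSet_Iic).comp measurable_fst).ennreal_toReal
  have : kernelQuantile κ ⁻¹' Iic x =
      ({p : 𝓧 × ℝ | p.2 ∈ Ioo (0 : ℝ) 1} ∩ {p | p.2 ≤ cdf (κ p.1) x}) ∪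
        ({p : 𝓧 × ℝ | p.2 ∈ Ioo (0 : ℝ) 1}ᶜ ∩ {_p | (0 : ℝ) ≤ x}) := by
    ext p
    by_cases hp : p.2 ∈ Ioo (0 : ℝ) 1
    · simp [kernelQuantile, quantile_le_iff _ hp, hp.1, hp.2]
    · simp only [mem_preimage, kernelQuantile, mem_Iic, mem_union, mem_inter_iff, if_false,
        mem_ofPred_eq, hp, mem_compl_iff, not_false_iff, false_and, true_and, false_or]
  rw [this]
  exact (hS.inter (measurableSet_le measurable_snd hm)).union
    (hS.compl.inter (MeasurableSet.const _))

lemma unif_Iic {c : ℝ} (h1 : c ≤ 1) : unif (Iic c) = ENNReal.ofReal c := by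
  rw [unif, Measure.restrict_apply measurableSet_Iic]
  have : Iic c ∩ Icc (0 : ℝ) 1 = Icc 0 c := by
    ext t; simp only [mem_inter_iff, mem_Iic, mem_Icc]
    constructor
    · rintro ⟨a, b, _⟩; exact ⟨b, a⟩
    · rintro ⟨a, b⟩; exact ⟨b, a, b.trans h1⟩
  rw [this, Real.volume_Icc, sub_zero]

lemma map_kernelQuantile {𝓧 : Type*} [MeasurableSpace 𝓧] (κ : Kernel 𝓧 ℝ)
    [IsMarkovKernel κ] (w : 𝓧) : unif.map (fun t => kernelQuantile κ (w, t)) = κ w := by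
  have hm : Measurable fun t => kernelQuantile κ (w, t) :=
    (measurable_kernelQuantile κ).comp measurable_prodMk_left
  have : IsProbabilityMeasure (unif.map fun t => kernelQuantile κ (w, t)) :=
    Measure.isProbabilityMeasure_map hm.aemeasurable
  refine Measure.ext_of_Iic _ _ fun x => ?_
  rw [Measure.map_apply hm measurableSet_Iic]
  have hae : (fun t => kernelQuantile κ (w, t)) ⁻¹' Iic x =ᵐ[unif] Iic (cdf (κ w) x) := by
    filter_upwards [ae_unif_mem_Ioo] with t ht
    have : (kernelQuantile κ (w, t) ≤ x) = (t ≤ cdf (κ w) x) := by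
      rw [kernelQuantile, if_pos ht, quantile_le_iff _ ht]
    exact this
  rw [measure_congr hae, unif_Iic (cdf_le_one _ _), ofReal_cdf]

lemma map_prod_kernelQuantile {𝓧 : Type*} [MeasurableSpace 𝓧] (μ : Measure 𝓧) [SFinite μ]
    (κ : Kernel 𝓧 ℝ) [IsMarkovKernel κ] :
    (μ.prod unif).map (fun p => (p.1, kernelQuantile κ p)) = μ ⊗ₘ κ := by
  have hm : Measurable fun p : 𝓧 × ℝ => (p.1, kernelQuantile κ p) :=
    measurable_fst.prodMk (measurable_kernelQuantile κ)
  ext s hs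
  rw [Measure.map_apply hm hs, Measure.prod_apply (hm hs), Measure.compProd_apply hs]
  refine lintegral_congr fun w => ?_
  have hw : Measurable fun t => kernelQuantile κ (w, t) :=
    (measurable_kernelQuantile κ).comp measurable_prodMk_left
  rw [← map_kernelQuantile κ w, Measure.map_apply hw (measurable_prodMk_left hs)]
  rfl

/-! ### The law of the inverse transform -/

/-- A coordinate of the inverse transform depends only on earlier ones, so dropping the last input
does not affect it. This drives the induction on `K`. -/
lemma invRosenblatt_castSucc {K : ℕ} (Q : (k : Fin (K + 1)) → Kernel (Fin (k : ℕ) → ℝ) ℝ)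
    (z : Fin (K + 1) → ℝ) (n : ℕ) (hn : n < K) :
    invRosenblatt Q z (Fin.castSucc ⟨n, hn⟩) =
      invRosenblatt (fun k : Fin K => Q k.castSucc) (fun k => z k.castSucc) ⟨n, hn⟩ := by
  induction n using Nat.strong_induction_on with
  | _ n ih =>
    rw [invRosenblatt_apply, invRosenblatt_apply (fun k : Fin K => Q k.castSucc)]
    congr 2
    refine funext fun i => ?_
    exact ih i i.2 (lt_trans i.2 hn)

lemma invRosenblatt_last {K : ℕ} (Q : (k : Fin (K + 1)) → Kernel (Fin (k : ℕ) → ℝ) ℝ)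
    (z : Fin (K + 1) → ℝ) :
    invRosenblatt Q z (Fin.last K) = quantile (Q (Fin.last K)
      (invRosenblatt (fun k : Fin K => Q k.castSucc) (fun k => z k.castSucc))) (z (Fin.last K)) := by
  rw [invRosenblatt_apply]
  congr 2
  refine funext fun i => ?_
  exact invRosenblatt_castSucc Q z i i.2

lemma measurePreserving_snoc (K : ℕ) :
    MeasurePreserving (fun p : (Fin K → ℝ) × ℝ => (Fin.snoc p.1 p.2 : Fin (K + 1) → ℝ))
      ((cube (Fin K)).prod unif) (cube (Fin (K + 1))) := by
  have h := (measurePreserving_piFinSuccAbove (fun _ : Fin (K + 1) => unif) (Fin.last K)).symm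
  have h2 := h.comp (Measure.measurePreserving_swap
    (μ := Measure.pi fun _ : Fin K => unif) (ν := unif))
  rw [cube_eq_pi, cube_eq_pi]
  convert h2 using 1
  funext p
  simp [MeasurableEquiv.piFinSuccAbove, Fin.insertNthEquiv, Function.comp]

/-- Induction on the number of inputs: given the law of the first `K` coordinates, an independent
uniform variable fed to the conditional quantile function samples the last one from its conditional
law. -/
theorem hasLaw_invRosenblatt {Ω : Type*} [MeasurableSpace Ω] (P : Measure Ω)
    [IsProbabilityMeasure P] {K : ℕ} (X : Ω → Fin K → ℝ) (hX : AEMeasurable X P)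
    (Q : (k : Fin K) → Kernel (Fin (k : ℕ) → ℝ) ℝ) [∀ k, IsMarkovKernel (Q k)]
    (hQ : ∀ k, HasCondDistrib (fun ω => X ω k) (fun ω => prefixOf (X ω) k) (Q k) P) :
    HasLaw (invRosenblatt Q) (P.map X) (cube (Fin K)) := by
  induction K with
  | zero =>
    have : IsProbabilityMeasure (P.map X) := Measure.isProbabilityMeasure_map hX
    have hm : Measurable (invRosenblatt Q) := measurable_of_subsingleton_codomain _
    have : IsProbabilityMeasure ((cube (Fin 0)).map (invRosenblatt Q)) :=
      Measure.isProbabilityMeasure_map hm.aemeasurable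
    refine ⟨hm.aemeasurable, ?_⟩
    ext s _
    rcases s.eq_empty_or_nonempty with h | h
    · simp [h]
    · simp [Subsingleton.eq_univ_of_nonempty h]
  | succ K ih =>
    set X' : Ω → Fin K → ℝ := fun ω k => X ω k.castSucc with hX'
    have hX'm : AEMeasurable X' P := by
      refine aemeasurable_pi_lambda _ fun k => ?_
      exact (measurable_pi_apply k.castSucc).comp_aemeasurable hX
    have hW := ih X' hX'm (fun k => Q k.castSucc) (fun k => hQ k.castSucc)
    set W := invRosenblatt (fun k : Fin K => Q k.castSucc) with hWdef
    -- The inverse transform is only known to be a.e. measurable, so a measurable version stands in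
    -- for it until the final a.e. comparison `hae`.
    set W' := hW.aemeasurable.mk W with hW'def
    have hWW' : W =ᵐ[cube (Fin K)] W' := hW.aemeasurable.ae_eq_mk
    have hW'm : Measurable W' := hW.aemeasurable.measurable_mk
    let κ : Kernel (Fin K → ℝ) ℝ := Q (Fin.last K)
    have : IsMarkovKernel κ := inferInstanceAs (IsMarkovKernel (Q (Fin.last K)))
    have : IsProbabilityMeasure (P.map X') := Measure.isProbabilityMeasure_map hX'm
    have hW'mp : MeasurePreserving W' (cube (Fin K)) (P.map X') :=
      ⟨hW'm, by rw [← hW.map_eq, Measure.map_congr hWW']⟩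
    have h1 := hW'mp.prod (MeasurePreserving.id unif)
    have h2 : MeasurePreserving (fun p : (Fin K → ℝ) × ℝ => (p.1, kernelQuantile κ p))
        ((P.map X').prod unif) ((P.map X') ⊗ₘ κ) :=
      ⟨measurable_fst.prodMk (measurable_kernelQuantile κ), map_prod_kernelQuantile _ κ⟩
    have hsn : Measurable fun p : (Fin K → ℝ) × ℝ => (Fin.snoc p.1 p.2 : Fin (K + 1) → ℝ) :=
      (measurePreserving_snoc K).measurable
    have h3 : MeasurePreserving
        (fun p : (Fin K → ℝ) × ℝ => (Fin.snoc p.1 p.2 : Fin (K + 1) → ℝ))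
        ((P.map X') ⊗ₘ κ) (P.map X) := by
      refine ⟨hsn, ?_⟩
      have hl : HasCondDistrib (fun ω => X ω (Fin.last K)) X' κ P := hQ (Fin.last K)
      have hl' : HasLaw (fun ω => (X' ω, X ω (Fin.last K))) ((P.map X') ⊗ₘ κ) P := hl
      rw [← hl'.map_eq, AEMeasurable.map_map_of_aemeasurable hsn.aemeasurable hl'.aemeasurable]
      congr 1
      funext ω
      exact Fin.snoc_init_self (X ω)
    have h4 := h3.comp (h2.comp h1)
    have h5 : MeasurePreserving (fun z : Fin (K + 1) → ℝ => ((fun k : Fin K => z k.castSucc,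
        z (Fin.last K)) : (Fin K → ℝ) × ℝ)) (cube (Fin (K + 1)))
        ((cube (Fin K)).prod unif) := by
      have hm : Measurable (fun z : Fin (K + 1) → ℝ => ((fun k : Fin K => z k.castSucc,
        z (Fin.last K)) : (Fin K → ℝ) × ℝ)) := by fun_prop
      refine ⟨hm, ?_⟩
      rw [← (measurePreserving_snoc K).map_eq, Measure.map_map hm hsn]
      convert Measure.map_id
      funext p
      simp [Function.comp]
    have h6 := h4.comp h5
    have hae : invRosenblatt Q =ᵐ[cube (Fin (K + 1))]
        (((fun p : (Fin K → ℝ) × ℝ => (Fin.snoc p.1 p.2 : Fin (K + 1) → ℝ)) ∘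
          (fun p => (p.1, kernelQuantile κ p)) ∘ Prod.map W' id) ∘
            fun z => (fun k : Fin K => z k.castSucc, z (Fin.last K))) := by
      have e1 := h5.quasiMeasurePreserving.ae
        ((Measure.quasiMeasurePreserving_fst).ae hWW')
      have e2 := h5.quasiMeasurePreserving.ae
        ((Measure.quasiMeasurePreserving_snd).ae ae_unif_mem_Ioo)
      filter_upwards [e1, e2] with z hz1 hz2
      have : invRosenblatt Q z = (Fin.snoc (W' fun k : Fin K => z k.castSucc)
          (kernelQuantile κ (W' (fun k : Fin K => z k.castSucc), z (Fin.last K))) :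
          Fin (K + 1) → ℝ) := by
        rw [← hz1, kernelQuantile, if_pos hz2]
        refine Fin.lastCases ?_ (fun k => ?_) |> funext
        · rw [Fin.snoc_last, invRosenblatt_last]
          rfl
        · rw [Fin.snoc_castSucc]
          exact invRosenblatt_castSucc Q z k k.2
      exact this
    refine ⟨h6.measurable.aemeasurable.congr hae.symm, ?_⟩
    rw [Measure.map_congr hae]
    exact h6.map_eq

/-! ### Main effects as marginal integrals -/

/-- The point of the cube with `k`-th coordinate `t` and the other coordinates given by `y`. -/
def insertCoord {K : ℕ} (k : Fin K) (t : ℝ) (y : {j : Fin K // j ≠ k} → ℝ) : Fin K → ℝ :=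
  fun j => if hj : j = k then t else y ⟨j, hj⟩

@[simp] lemma insertCoord_self {K : ℕ} (k : Fin K) (t : ℝ) (y : {j : Fin K // j ≠ k} → ℝ) :
    insertCoord k t y k = t := by simp [insertCoord]

lemma measurePreserving_insertCoord {K : ℕ} (k : Fin K) :
    MeasurePreserving (fun p : ℝ × ({j : Fin K // j ≠ k} → ℝ) => insertCoord k p.1 p.2)
      (unif.prod (cube {j : Fin K // j ≠ k})) (cube (Fin K)) := by
  have hm : Measurable fun p : ℝ × ({j : Fin K // j ≠ k} → ℝ) => insertCoord k p.1 p.2 := by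
    refine measurable_pi_lambda _ fun j => ?_
    by_cases hj : j = k
    · simpa [insertCoord, hj] using measurable_fst
    · simp only [insertCoord, hj, dite_false]
      fun_prop
  refine ⟨hm, ?_⟩
  rw [cube_eq_pi (Fin K)]
  refine (Measure.pi_eq fun s hs => ?_).symm
  rw [Measure.map_apply hm (MeasurableSet.univ_pi hs)]
  have : (fun p : ℝ × ({j : Fin K // j ≠ k} → ℝ) => insertCoord k p.1 p.2) ⁻¹' univ.pi s =
      s k ×ˢ univ.pi fun j : {j : Fin K // j ≠ k} => s j := by
    ext p
    simp only [mem_preimage, mem_univ_pi, mem_prod]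
    constructor
    · intro h
      refine ⟨by simpa using h k, fun j => ?_⟩
      simpa [insertCoord, j.2] using h j
    · rintro ⟨h1, h2⟩ j
      by_cases hj : j = k
      · subst hj; simpa using h1
      · simpa [insertCoord, hj] using h2 ⟨j, hj⟩
  rw [this, Measure.prod_prod, cube_eq_pi, Measure.pi_pi,
    Fintype.prod_eq_mul_prod_subtype_ne (fun i => unif (s i)) k]

/-- The integral of `f` over all coordinates but the `k`-th, as a function of the latter. -/
def margin {K : ℕ} (f : (Fin K → ℝ) → ℝ) (k : Fin K) (t : ℝ) : ℝ :=
  ∫ y, f (insertCoord k t y) ∂(cube {j : Fin K // j ≠ k})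

lemma sq_integral_le {α : Type*} [MeasurableSpace α] {μ : Measure α} [IsProbabilityMeasure μ]
    {f : α → ℝ} (hf : MemLp f 2 μ) : (∫ x, f x ∂μ) ^ 2 ≤ ∫ x, f x ^ 2 ∂μ := by
  have h := variance_nonneg f μ
  rw [variance_eq_sub hf] at h
  simpa using h

section Margin

variable {K : ℕ} {f : (Fin K → ℝ) → ℝ}

/-- Jensen on each fibre, then Fubini. -/
lemma memLp_margin (hf : MemLp f 2 (cube (Fin K))) (k : Fin K) : MemLp (margin f k) 2 unif := by
  have h2 := hf.comp_measurePreserving (measurePreserving_insertCoord k)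
  have hsm : AEStronglyMeasurable (margin f k) unif :=
    h2.aestronglyMeasurable.integral_prod_right'
  rw [memLp_two_iff_integrable_sq hsm]
  have hsq := h2.integrable_sq
  refine hsq.integral_prod_left.mono' (hsm.pow 2) ?_
  filter_upwards [hsq.prod_right_ae, h2.aestronglyMeasurable.prodMk_left] with t h3 h4
  rw [Real.norm_of_nonneg (sq_nonneg _)]
  exact sq_integral_le ((memLp_two_iff_integrable_sq h4).2 h3)

lemma measurePreserving_eval_cube (k : Fin K) :
    MeasurePreserving (fun z : Fin K → ℝ => z k) (cube (Fin K)) unif := by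
  rw [cube_eq_pi]
  exact measurePreserving_eval (fun _ : Fin K => unif) k

/-- The defining property of `margin f k` as the conditional expectation of `f` given the `k`-th
coordinate. -/
lemma integral_mul_comp_eval (k : Fin K) (ψ : ℝ → ℝ)
    (hi : Integrable (fun z => f z * ψ (z k)) (cube (Fin K))) :
    ∫ z, f z * ψ (z k) ∂(cube (Fin K)) = ∫ t, margin f k t * ψ t ∂unif := by
  have hmp := measurePreserving_insertCoord k
  have hi2 := hmp.integrable_comp_of_integrable hi
  rw [← hmp.map_eq, integral_map hmp.measurable.aemeasurable
    (by rw [hmp.map_eq]; exact hi.aestronglyMeasurable)]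
  refine (integral_prod _ hi2).trans (integral_congr_ae (.of_forall fun t => ?_))
  simp only [insertCoord_self, Function.comp, margin, integral_mul_const]

lemma integral_margin (hf : MemLp f 2 (cube (Fin K))) (k : Fin K) :
    ∫ t, margin f k t ∂unif = ∫ z, f z ∂(cube (Fin K)) := by
  simpa using (integral_mul_comp_eval (f := f) k (fun _ => 1)
    (by simpa using hf.integrable one_le_two)).symm

lemma memLp_margin_eval (hf : MemLp f 2 (cube (Fin K))) (k : Fin K) :
    MemLp (fun z => margin f k (z k)) 2 (cube (Fin K)) :=
  (memLp_margin hf k).comp_measurePreserving (measurePreserving_eval_cube k)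

lemma integral_comp_eval (k : Fin K) {φ : ℝ → ℝ} (hφ : AEStronglyMeasurable φ unif) :
    ∫ z, φ (z k) ∂(cube (Fin K)) = ∫ t, φ t ∂unif := by
  have hmp := measurePreserving_eval_cube (K := K) k
  rw [← hmp.map_eq, integral_map hmp.measurable.aemeasurable (by rwa [hmp.map_eq])]

/-- Distinct main effects are independent and centred, hence orthogonal. -/
lemma integral_margin_mul_margin (hf : MemLp f 2 (cube (Fin K)))
    (h0 : ∫ z, f z ∂(cube (Fin K)) = 0) (j k : Fin K) :
    ∫ z, margin f j (z j) * margin f k (z k) ∂(cube (Fin K)) =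
      if j = k then ∫ t, margin f k t ^ 2 ∂unif else 0 := by
  split_ifs with hjk
  · subst hjk
    simp only [← sq]
    exact integral_comp_eval j ((memLp_margin hf j).aestronglyMeasurable.pow 2)
  · have hind : IndepFun (fun z : Fin K → ℝ => margin f j (z j)) (fun z => margin f k (z k))
        (cube (Fin K)) := by
      rw [cube_eq_pi]
      exact (iIndepFun_pi (X := fun i : Fin K => margin f i) (μ := fun _ : Fin K => unif)
        fun i => (memLp_margin hf i).aestronglyMeasurable.aemeasurable).indepFun hjk
    rw [hind.integral_fun_mul_eq_mul_integral (memLp_margin_eval hf j).aestronglyMeasurable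
      (memLp_margin_eval hf k).aestronglyMeasurable,
      integral_comp_eval j (memLp_margin hf j).aestronglyMeasurable, integral_margin hf, h0,
      zero_mul]

lemma memLp_sub_sum_margin (hf : MemLp f 2 (cube (Fin K))) :
    MemLp (fun z => f z - ∑ k, margin f k (z k)) 2 (cube (Fin K)) :=
  hf.sub (memLp_finsetSum _ fun k _ => memLp_margin_eval hf k)

/-- The squared norm of the residual of the projection onto the additive functions. -/
theorem integral_sq_sub_sum_margin (hf : MemLp f 2 (cube (Fin K)))
    (h0 : ∫ z, f z ∂(cube (Fin K)) = 0) :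
    ∫ z, (f z - ∑ k, margin f k (z k)) ^ 2 ∂(cube (Fin K)) =
      ∫ z, f z ^ 2 ∂(cube (Fin K)) - ∑ k, ∫ t, margin f k t ^ 2 ∂unif := by
  have hα := memLp_margin_eval hf
  have hfα : ∀ k, Integrable (fun z => f z * margin f k (z k)) (cube (Fin K)) :=
    fun k => hf.integrable_mul (hα k)
  have hαα : ∀ j k, Integrable (fun z => margin f j (z j) * margin f k (z k)) (cube (Fin K)) :=
    fun j k => (hα j).integrable_mul (hα k)
  have hexp : ∀ z : Fin K → ℝ, (f z - ∑ k, margin f k (z k)) ^ 2 =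
      f z ^ 2 - 2 * ∑ k, f z * margin f k (z k) +
        ∑ j, ∑ k, margin f j (z j) * margin f k (z k) := by
    intro z
    rw [← Finset.mul_sum, ← Finset.sum_mul_sum]
    ring
  simp only [hexp]
  have i1 : Integrable (fun z => 2 * ∑ k, f z * margin f k (z k)) (cube (Fin K)) :=
    (integrable_finsetSum _ fun k _ => hfα k).const_mul 2
  have i2 : Integrable (fun z : Fin K → ℝ => ∑ j, ∑ k, margin f j (z j) * margin f k (z k))
      (cube (Fin K)) :=
    integrable_finsetSum _ fun j _ => integrable_finsetSum _ fun k _ => hαα j k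
  have i3 : Integrable (fun z => f z ^ 2 - 2 * ∑ k, f z * margin f k (z k)) (cube (Fin K)) :=
    hf.integrable_sq.sub i1
  rw [integral_add i3 i2, integral_sub hf.integrable_sq i1,
    integral_const_mul, integral_finsetSum _ fun k _ => hfα k,
    integral_finsetSum _ fun j _ => integrable_finsetSum _ fun k _ => hαα j k]
  -- The cross term and the double sum both reduce to `∑ ∫ α_k²`, with coefficients `-2` and `1`.
  have e1 : ∀ k, ∫ z, f z * margin f k (z k) ∂(cube (Fin K)) = ∫ t, margin f k t ^ 2 ∂unif := by
    intro k
    rw [integral_mul_comp_eval k _ (hfα k)]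
    simp only [sq]
  have e2 : ∀ j, ∫ z, ∑ k, margin f j (z j) * margin f k (z k) ∂(cube (Fin K)) =
      ∫ t, margin f j t ^ 2 ∂unif := by
    intro j
    rw [integral_finsetSum _ fun k _ => hαα j k]
    simp [integral_margin_mul_margin hf h0]
  simp only [e1, e2]
  ring

end Margin

/-! ### Averages over the cells of a regular grid -/

/-- The `m`-th cell of the regular partition of the unit interval into `N` cells. -/
def cell (N : ℕ) (m : Fin N) : Set ℝ := Ioc (((m : ℕ) : ℝ) / N) ((((m : ℕ) : ℝ) + 1) / N)

lemma measurableSet_cell {N : ℕ} (m : Fin N) : MeasurableSet (cell N m) := measurableSet_Ioc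

lemma cell_subset {N : ℕ} (m : Fin N) : cell N m ⊆ Icc 0 1 := by
  have hN : (0 : ℝ) < N := by exact_mod_cast m.pos
  rintro t ⟨h1, h2⟩
  refine ⟨le_trans (by positivity) h1.le, h2.trans ?_⟩
  rw [div_le_one hN]
  exact_mod_cast m.2

lemma unif_real_cell {N : ℕ} (m : Fin N) : unif.real (cell N m) = 1 / N := by
  have hN : (0 : ℝ) < N := by exact_mod_cast m.pos
  rw [unif, measureReal_restrict_apply (measurableSet_cell m),
    inter_eq_self_of_subset_left (cell_subset m), cell, measureReal_def, Real.volume_Ioc,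
    ENNReal.toReal_ofReal]
  · ring
  · rw [sub_nonneg]; gcongr; linarith

/-- Reading the cell index off a ceiling yields both disjointness and covering. -/
lemma mem_cell_iff {N : ℕ} (m : Fin N) (t : ℝ) :
    t ∈ cell N m ↔ ⌈t * N⌉ = ((m : ℕ) : ℤ) + 1 := by
  have hN : (0 : ℝ) < N := by exact_mod_cast m.pos
  rw [Int.ceil_eq_iff, cell, mem_Ioc, div_lt_iff₀ hN, le_div_iff₀ hN]
  push_cast
  simp

lemma pairwise_disjoint_cell (N : ℕ) : Pairwise (Function.onFun Disjoint (cell N)) := by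
  intro m m' hmm
  refine Set.disjoint_left.2 fun t h1 h2 => hmm ?_
  rw [mem_cell_iff] at h1 h2
  exact Fin.ext (by omega)

lemma iUnion_cell {N : ℕ} (hN : 0 < N) : ⋃ m, cell N m = Ioc 0 1 := by
  have hN' : (0 : ℝ) < N := by exact_mod_cast hN
  ext t
  simp only [mem_iUnion, mem_cell_iff]
  constructor
  · rintro ⟨m, hm⟩
    rw [← mem_cell_iff] at hm
    exact ⟨lt_of_le_of_lt (by positivity) hm.1, (cell_subset m hm).2⟩
  · rintro ⟨h0, h1⟩
    have hp : 0 < ⌈t * N⌉ := Int.ceil_pos.2 (by positivity)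
    have hle : ⌈t * N⌉ ≤ N := Int.ceil_le.2 (by push_cast; nlinarith)
    refine ⟨⟨(⌈t * N⌉ - 1).toNat, by omega⟩, ?_⟩
    simp only
    omega

lemma integral_eq_sum_cell {N : ℕ} (hN : 0 < N) {φ : ℝ → ℝ} (hφ : Integrable φ unif) :
    ∫ t, φ t ∂unif = ∑ m, ∫ t in cell N m, φ t ∂unif := by
  rw [← integral_iUnion_fintype measurableSet_cell (pairwise_disjoint_cell N)
    fun _ => hφ.integrableOn, iUnion_cell hN]
  refine (Measure.restrict_eq_self_of_ae_mem ?_).symm ▸ rfl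
  filter_upwards [ae_unif_mem_Ioo] with t ht using ⟨ht.1, ht.2.le⟩

/-- As a quadratic in `c` this is minimal at the cell average `N * ∫ φ`. Nonnegativity of the
minimum and its minimality give the next two lemmas. -/
lemma integral_cell_sub_sq {N : ℕ} (m : Fin N) {φ : ℝ → ℝ} (hφ : MemLp φ 2 unif) (c : ℝ) :
    ∫ t in cell N m, (φ t - c) ^ 2 ∂unif =
      ∫ t in cell N m, φ t ^ 2 ∂unif - 2 * c * ∫ t in cell N m, φ t ∂unif + c ^ 2 / N := by
  have i1 : Integrable φ (unif.restrict (cell N m)) := (hφ.integrable one_le_two).integrableOn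
  have i2 : Integrable (fun t => φ t ^ 2) (unif.restrict (cell N m)) :=
    hφ.integrable_sq.integrableOn
  have i3 : Integrable (fun t => φ t ^ 2 - 2 * c * φ t) (unif.restrict (cell N m)) :=
    i2.sub (i1.const_mul (2 * c))
  have e : ∀ t, (φ t - c) ^ 2 = φ t ^ 2 - 2 * c * φ t + c ^ 2 := fun t => by ring
  simp only [e]
  rw [integral_add i3 (integrable_const _), integral_sub i2 (i1.const_mul _), integral_const_mul,
    setIntegral_const, unif_real_cell, smul_eq_mul]
  ring

lemma mul_sq_integral_cell_le {N : ℕ} (m : Fin N) {φ : ℝ → ℝ} (hφ : MemLp φ 2 unif) :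
    N * (∫ t in cell N m, φ t ∂unif) ^ 2 ≤ ∫ t in cell N m, φ t ^ 2 ∂unif := by
  have hN : (0 : ℝ) < N := by exact_mod_cast m.pos
  have h := integral_cell_sub_sq m hφ (N * ∫ t in cell N m, φ t ∂unif)
  have h0 : 0 ≤ ∫ t in cell N m, (φ t - N * ∫ t in cell N m, φ t ∂unif) ^ 2 ∂unif :=
    integral_nonneg fun t => sq_nonneg _
  rw [h] at h0
  have e : (N * ∫ t in cell N m, φ t ∂unif) ^ 2 / N = N * (∫ t in cell N m, φ t ∂unif) ^ 2 := by
    field_simp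
  rw [e] at h0
  nlinarith [h0]

lemma integral_cell_sq_sub_le {N : ℕ} (m : Fin N) {φ : ℝ → ℝ} (hφ : MemLp φ 2 unif) (c : ℝ) :
    ∫ t in cell N m, φ t ^ 2 ∂unif - N * (∫ t in cell N m, φ t ∂unif) ^ 2 ≤
      ∫ t in cell N m, (φ t - c) ^ 2 ∂unif := by
  have hN : (0 : ℝ) < N := by exact_mod_cast m.pos
  rw [integral_cell_sub_sq m hφ c]
  have h : 0 ≤ N * (∫ t in cell N m, φ t ∂unif - c / N) ^ 2 := by positivity
  have e : N * (∫ t in cell N m, φ t ∂unif - c / N) ^ 2 =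
      N * (∫ t in cell N m, φ t ∂unif) ^ 2 - 2 * c * ∫ t in cell N m, φ t ∂unif + c ^ 2 / N := by
    field_simp
    ring
  linarith

/-- The squared norms of the projections of a square integrable function onto the step functions
on the regular grids converge to its squared norm. -/
theorem tendsto_sum_sq_integral_cell {φ : ℝ → ℝ} (hφ : MemLp φ 2 unif) :
    Tendsto (fun N : ℕ => (N : ℝ) * ∑ m : Fin N, (∫ t in cell N m, φ t ∂unif) ^ 2) atTop
      (nhds (∫ t, φ t ^ 2 ∂unif)) := by
  rw [Metric.tendsto_atTop]
  intro ε hε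
  -- Approximation by a uniformly continuous `g`. The `L²` error and the oscillation of `g` on a
  -- cell each cost `2 * (ε / 8)`, for a total of `ε / 2`.
  obtain ⟨g, hgc, hgε, hg, hgL⟩ := MemLp.exists_hasCompactSupport_integral_rpow_sub_le
    (μ := unif) (p := 2) two_pos (by simpa using hφ) (show 0 < ε / 8 by positivity)
  have hgL2 : MemLp g 2 unif := by simpa using hgL
  have hgε' : ∫ t, (φ t - g t) ^ 2 ∂unif ≤ ε / 8 := by
    simpa [Real.norm_eq_abs, sq_abs] using hgε
  obtain ⟨δ, hδ, hgδ⟩ := Metric.uniformContinuous_iff.1 (hgc.uniformContinuous_of_continuous hg)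
    (Real.sqrt (ε / 8)) (Real.sqrt_pos.2 (by positivity))
  obtain ⟨N₀, hN₀⟩ := exists_nat_gt (1 / δ)
  refine ⟨N₀ + 1, fun N hN => ?_⟩
  have hNpos : 0 < N := by omega
  have hNr : (0 : ℝ) < N := by exact_mod_cast hNpos
  have hδN : 1 / (N : ℝ) < δ := by
    rw [div_lt_iff₀ hNr, ← div_lt_iff₀' hδ]
    have : (N₀ : ℝ) ≤ N := by exact_mod_cast (by omega : N₀ ≤ N)
    linarith
  have hφg : MemLp (fun t => φ t - g t) 2 unif := hφ.sub hgL2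
  have key : ∀ m : Fin N, ∫ t in cell N m, φ t ^ 2 ∂unif -
      N * (∫ t in cell N m, φ t ∂unif) ^ 2 ≤
      2 * ∫ t in cell N m, (φ t - g t) ^ 2 ∂unif + 2 * (ε / 8) * (1 / N) := by
    intro m
    -- The competing constant is the value of `g` at the left end of the cell.
    refine (integral_cell_sq_sub_le m hφ (g ((m : ℕ) / N))).trans ?_
    have i1 : Integrable (fun t => 2 * (φ t - g t) ^ 2) (unif.restrict (cell N m)) :=
      (hφg.integrable_sq.const_mul 2).integrableOn
    have e : 2 * ∫ t in cell N m, (φ t - g t) ^ 2 ∂unif + 2 * (ε / 8) * (1 / N) =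
        ∫ t in cell N m, (2 * (φ t - g t) ^ 2 + 2 * (ε / 8)) ∂unif := by
      rw [integral_add i1 (integrable_const _), integral_const_mul, setIntegral_const,
        unif_real_cell, smul_eq_mul]
      ring
    rw [e]
    refine setIntegral_mono_on
      ((hφ.sub (memLp_const (g ((m : ℕ) / N)))).integrable_sq.integrableOn)
      (i1.add (integrable_const _)) (measurableSet_cell m) fun t ht => ?_
    have hd : dist t ((m : ℕ) / N) < δ := by
      rw [Real.dist_eq, abs_of_pos (sub_pos.2 ht.1)]
      have := ht.2
      rw [add_div] at this
      linarith
    have h1 := hgδ hd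
    rw [Real.dist_eq] at h1
    have h2 : (g t - g ((m : ℕ) / N)) ^ 2 ≤ ε / 8 := by
      rw [← sq_abs, ← Real.sq_sqrt (show 0 ≤ ε / 8 by positivity)]
      gcongr
    nlinarith [sq_nonneg ((φ t - g t) - (g t - g ((m : ℕ) / N)))]
  have hsum := Finset.sum_le_sum fun m (_ : m ∈ Finset.univ) => key m
  rw [Finset.sum_sub_distrib, ← integral_eq_sum_cell hNpos hφ.integrable_sq,
    Finset.sum_add_distrib, ← Finset.mul_sum, ← Finset.mul_sum,
    ← integral_eq_sum_cell hNpos hφg.integrable_sq] at hsum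
  have hone : ∑ _m : Fin N, 2 * (ε / 8) * (1 / (N : ℝ)) = 2 * (ε / 8) := by
    simp; field_simp
  have hlow := Finset.sum_le_sum fun m (_ : m ∈ (Finset.univ : Finset (Fin N))) =>
    mul_sq_integral_cell_le m hφ
  rw [← Finset.mul_sum, ← integral_eq_sum_cell hNpos hφ.integrable_sq] at hlow
  rw [Real.dist_eq, abs_sub_comm, abs_of_nonneg (sub_nonneg.2 hlow)]
  linarith

/-! ### The cube as a union of grid boxes -/

/-- The point with relative position `u` in the box with index `c` of the regular grid. -/
def gridPoint {N K : ℕ} (c : Fin K → Fin N) (u : Fin K → ℝ) : Fin K → ℝ :=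
  fun k => (((c k : ℕ) : ℝ) + 1 - u k) / (N : ℝ)

/-- The box with index `c` of the regular grid. -/
def box {N K : ℕ} (c : Fin K → Fin N) : Set (Fin K → ℝ) := univ.pi fun k => cell N (c k)

lemma measurable_gridPoint {N K : ℕ} (c : Fin K → Fin N) : Measurable (gridPoint c) := by
  unfold gridPoint
  fun_prop

lemma measurableSet_box {N K : ℕ} (c : Fin K → Fin N) : MeasurableSet (box c) :=
  MeasurableSet.univ_pi fun _ => measurableSet_cell _

lemma map_unif_cell {N : ℕ} (m : Fin N) :
    unif.map (fun u => (((m : ℕ) : ℝ) + 1 - u) / (N : ℝ)) =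
      (N : ENNReal) • unif.restrict (cell N m) := by
  have hN : (0 : ℝ) < N := by exact_mod_cast m.pos
  have hmeas : Measurable fun u : ℝ => (((m : ℕ) : ℝ) + 1 - u) / (N : ℝ) := by fun_prop
  have hpre : (fun u : ℝ => (((m : ℕ) : ℝ) + 1 - u) / (N : ℝ)) ⁻¹' cell N m = Ico 0 1 := by
    ext u
    simp only [mem_preimage, cell, mem_Ioc, mem_Ico, div_lt_div_iff_of_pos_right hN,
      div_le_div_iff_of_pos_right hN]
    constructor <;> rintro ⟨h1, h2⟩ <;> constructor <;> linarith
  have hvol : (volume : Measure ℝ).map (fun u => (((m : ℕ) : ℝ) + 1 - u) / (N : ℝ)) =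
      (N : ENNReal) • volume := by
    have h1 := (Measure.measurePreserving_sub_left (volume : Measure ℝ) (((m : ℕ) : ℝ) + 1)).map_eq
    have h2 := Real.map_volume_mul_right (inv_ne_zero hN.ne')
    rw [inv_inv, abs_of_pos hN, ENNReal.ofReal_natCast] at h2
    rw [← h2]
    conv_rhs => rw [← h1, Measure.map_map (by fun_prop) (by fun_prop)]
    rfl
  -- Since `u` enters with a minus sign, the left-open cell pulls back to `[0,1)`, which differs
  -- from `[0,1]` by a null set.
  have h3 : unif = (volume : Measure ℝ).restrict (Ico 0 1) := restrict_Ico_eq_restrict_Icc.symm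
  have h4 : unif.restrict (cell N m) = (volume : Measure ℝ).restrict (cell N m) := by
    rw [unif, Measure.restrict_restrict (measurableSet_cell m),
      inter_eq_self_of_subset_left (cell_subset m)]
  rw [h4, h3, ← hpre, ← Measure.restrict_map hmeas (measurableSet_cell m), hvol,
    Measure.restrict_smul]

lemma map_gridPoint {N K : ℕ} (c : Fin K → Fin N) :
    (cube (Fin K)).map (gridPoint c) = (N : ENNReal) ^ K • (cube (Fin K)).restrict (box c) := by
  have hm : ∀ k, AEMeasurable (fun u : ℝ => (((c k : ℕ) : ℝ) + 1 - u) / (N : ℝ)) unif :=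
    fun k => by fun_prop
  have : ∀ k, IsProbabilityMeasure (unif.map fun u => (((c k : ℕ) : ℝ) + 1 - u) / (N : ℝ)) :=
    fun k => Measure.isProbabilityMeasure_map (hm k)
  rw [cube_eq_pi, box, Measure.restrict_pi_pi]
  have h := Measure.pi_map_pi (μ := fun _ : Fin K => unif) hm
  refine h.trans (Measure.pi_eq fun s _ => ?_)
  simp only [map_unif_cell, Measure.smul_apply, Measure.pi_pi, smul_eq_mul,
    Finset.prod_mul_distrib, Finset.prod_const, Finset.card_univ, Fintype.card_fin]

section Grid

variable {N K : ℕ} {f : (Fin K → ℝ) → ℝ}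

lemma memLp_comp_gridPoint (hf : MemLp f 2 (cube (Fin K))) (c : Fin K → Fin N) :
    MemLp (fun u => f (gridPoint c u)) 2 (cube (Fin K)) := by
  have h : MemLp f 2 ((cube (Fin K)).map (gridPoint c)) := by
    rw [map_gridPoint]
    exact (hf.restrict _).smul_measure (by simp)
  exact h.comp_of_map (measurable_gridPoint c).aemeasurable

lemma integral_comp_gridPoint (hf : AEStronglyMeasurable f (cube (Fin K))) (c : Fin K → Fin N) :
    ∫ u, f (gridPoint c u) ∂(cube (Fin K)) = (N : ℝ) ^ K * ∫ z in box c, f z ∂(cube (Fin K)) := by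
  have h : AEStronglyMeasurable f ((cube (Fin K)).map (gridPoint c)) := by
    rw [map_gridPoint]
    exact hf.restrict.smul_measure _
  rw [← integral_map (measurable_gridPoint c).aemeasurable h, map_gridPoint, integral_smul_measure]
  simp

lemma pairwise_disjoint_box (N K : ℕ) :
    Pairwise (Function.onFun Disjoint (box : (Fin K → Fin N) → Set (Fin K → ℝ))) := by
  intro c c' hcc
  obtain ⟨k, hk⟩ := Function.ne_iff.1 hcc
  refine Set.disjoint_left.2 fun z h1 h2 => ?_
  exact Set.disjoint_left.1 (pairwise_disjoint_cell N hk) (h1 k (mem_univ _)) (h2 k (mem_univ _))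

lemma ae_mem_iUnion_box (hN : 0 < N) :
    ∀ᵐ z ∂(cube (Fin K)), z ∈ ⋃ c : Fin K → Fin N, box c := by
  have h : ∀ k : Fin K, ∀ᵐ z ∂(cube (Fin K)), z k ∈ Ioo (0 : ℝ) 1 := fun k =>
    (measurePreserving_eval_cube k).quasiMeasurePreserving.ae ae_unif_mem_Ioo
  filter_upwards [ae_all_iff.2 h] with z hz
  have h2 : ∀ k, ∃ m, z k ∈ cell N m := fun k => by
    rw [← mem_iUnion, iUnion_cell hN]
    exact ⟨(hz k).1, (hz k).2.le⟩
  choose c hc using h2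
  exact mem_iUnion.2 ⟨c, fun k _ => hc k⟩

lemma integral_eq_sum_box (hN : 0 < N) (hf : Integrable f (cube (Fin K))) :
    ∫ z, f z ∂(cube (Fin K)) = ∑ c : Fin K → Fin N, ∫ z in box c, f z ∂(cube (Fin K)) := by
  rw [← integral_iUnion_fintype measurableSet_box (pairwise_disjoint_box N K)
    fun _ => hf.integrableOn]
  exact integral_eq_setIntegral (ae_mem_iUnion_box hN) f

/-- The boxes with `k`-th index `m` tile the slab `z k ∈ cell N m` up to a null set; Fubini
evaluates the integral over the slab. -/
lemma sum_box_eq_integral_cell (hf : MemLp f 2 (cube (Fin K))) (k : Fin K) (m : Fin N) :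
    ∑ c : Fin K → Fin N, (if c k = m then ∫ z in box c, f z ∂(cube (Fin K)) else 0) =
      ∫ t in cell N m, margin f k t ∂unif := by
  have hψ : Integrable (fun z => f z * (cell N m).indicator 1 (z k)) (cube (Fin K)) := by
    have h1 : MeasurableSet {z : Fin K → ℝ | z k ∈ cell N m} :=
      measurable_pi_apply k (measurableSet_cell m)
    refine ((hf.integrable one_le_two).indicator h1).congr (.of_forall fun z => ?_)
    by_cases hz : z k ∈ cell N m <;> simp [hz]
  have h := integral_mul_comp_eval k _ hψ
  rw [integral_eq_sum_box m.pos hψ] at h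
  have h3 : ∫ t in cell N m, margin f k t ∂unif =
      ∫ t, margin f k t * (cell N m).indicator 1 t ∂unif := by
    rw [← integral_indicator (measurableSet_cell m)]
    congr 1
    ext t
    by_cases ht : t ∈ cell N m <;> simp [ht]
  rw [h3, ← h]
  refine Finset.sum_congr rfl fun c _ => ?_
  split_ifs with hc
  · refine setIntegral_congr_fun (measurableSet_box c) fun z hz => ?_
    have : z k ∈ cell N m := hc ▸ hz k (mem_univ _)
    simp [this]
  · symm
    refine setIntegral_eq_zero_of_forall_eq_zero fun z hz => ?_
    have : z k ∉ cell N m := fun h1 =>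
      Set.disjoint_left.1 (pairwise_disjoint_cell N hc) (hz k (mem_univ _)) h1
    simp [this]

lemma mul_sq_integral_box_le (hf : MemLp f 2 (cube (Fin K))) (hN : 0 < N) (c : Fin K → Fin N) :
    (N : ℝ) ^ K * (∫ z in box c, f z ∂(cube (Fin K))) ^ 2 ≤
      ∫ z in box c, f z ^ 2 ∂(cube (Fin K)) := by
  have hNK : (0 : ℝ) < (N : ℝ) ^ K := by positivity
  have h := sq_integral_le (memLp_comp_gridPoint hf c)
  rw [integral_comp_gridPoint hf.aestronglyMeasurable,
    integral_comp_gridPoint (f := fun z => f z ^ 2) (hf.aestronglyMeasurable.pow 2)] at h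
  refine le_of_mul_le_mul_left ?_ hNK
  linarith [h]

/-! ### Sums over pairs of boxes -/

/-- The sum of the products of the integrals of `f` over pairs of boxes whose indices agree in all
coordinates in `S`. -/
def pairSum (f : (Fin K → ℝ) → ℝ) (N : ℕ) (S : Finset (Fin K)) : ℝ :=
  ∑ c : Fin K → Fin N, ∑ c' : Fin K → Fin N,
    (∫ z in box c, f z ∂(cube (Fin K))) * (∫ z in box c', f z ∂(cube (Fin K))) *
      ∏ k ∈ S, (if c k = c' k then 1 else 0)

lemma pairSum_empty (hf : MemLp f 2 (cube (Fin K))) (hN : 0 < N) :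
    pairSum f N ∅ = (∫ z, f z ∂(cube (Fin K))) ^ 2 := by
  simp only [pairSum, Finset.prod_empty, mul_one]
  rw [← Finset.sum_mul_sum, ← integral_eq_sum_box hN (hf.integrable one_le_two), sq]

lemma pairSum_singleton (hf : MemLp f 2 (cube (Fin K))) (k : Fin K) :
    pairSum f N {k} = ∑ m : Fin N, (∫ t in cell N m, margin f k t ∂unif) ^ 2 := by
  simp only [pairSum, Finset.prod_singleton, ← sum_box_eq_integral_cell hf k, sq,
    Finset.sum_mul_sum]
  rw [Finset.sum_comm]
  conv_rhs => rw [Finset.sum_comm]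
  rw [Finset.sum_comm]
  refine Finset.sum_congr rfl fun c _ => ?_
  rw [Finset.sum_comm]
  refine Finset.sum_congr rfl fun c' _ => ?_
  simp only [ite_mul, zero_mul, Finset.sum_ite_eq, Finset.mem_univ, if_true, mul_ite, mul_one,
    mul_zero]

/-- Exactly `N ^ (K - |S|)` indices agree with `c` on `S`; the sum of products factors over
coordinates. -/
lemma mul_sum_prod_agree (S : Finset (Fin K)) (c : Fin K → Fin N) :
    (N : ℝ) ^ S.card * ∑ c' : Fin K → Fin N, ∏ k ∈ S, (if c k = c' k then (1 : ℝ) else 0) =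
      (N : ℝ) ^ K := by
  have h1 : ∀ c' : Fin K → Fin N, ∏ k ∈ S, (if c k = c' k then (1 : ℝ) else 0) =
      ∏ k, (if k ∈ S then (if c k = c' k then (1 : ℝ) else 0) else 1) := fun c' => by
    rw [Finset.prod_ite_mem, Finset.univ_inter]
  have h2 : (N : ℝ) ^ S.card = ∏ k : Fin K, (if k ∈ S then (N : ℝ) else 1) := by
    rw [Finset.prod_ite_mem, Finset.univ_inter, Finset.prod_const]
  simp only [h1]
  rw [h2, ← Fintype.piFinset_univ, ← Finset.prod_univ_sum (fun _ => Finset.univ)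
    (fun k m => if k ∈ S then (if c k = m then (1 : ℝ) else 0) else 1), ← Finset.prod_mul_distrib]
  have h3 : ∀ k, ((if k ∈ S then (N : ℝ) else 1) *
      ∑ m : Fin N, (if k ∈ S then (if c k = m then (1 : ℝ) else 0) else 1)) = N := fun k => by
    split_ifs <;> simp
  rw [Finset.prod_congr rfl fun k _ => h3 k]
  simp

/-- A Schur test: `|H c * H c'| ≤ (H c² + H c'²) / 2`, the agreement matrix is symmetric with row
sums `N ^ (K - |S|)`, and Jensen on each box bounds `N ^ K * H c²`. -/
lemma abs_pairSum_le (hf : MemLp f 2 (cube (Fin K))) (hN : 0 < N) (S : Finset (Fin K)) :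
    (N : ℝ) ^ S.card * |pairSum f N S| ≤ ∫ z, f z ^ 2 ∂(cube (Fin K)) := by
  set H : (Fin K → Fin N) → ℝ := fun c => ∫ z in box c, f z ∂(cube (Fin K)) with hH
  set A : (Fin K → Fin N) → (Fin K → Fin N) → ℝ :=
    fun c c' => ∏ k ∈ S, (if c k = c' k then 1 else 0) with hA
  have hA0 : ∀ c c', 0 ≤ A c c' := fun c c' =>
    Finset.prod_nonneg fun k _ => by split_ifs <;> norm_num
  have hAs : ∀ c c', A c c' = A c' c := fun c c' => by simp only [hA, eq_comm]
  have h1 : |pairSum f N S| ≤ ∑ c, H c ^ 2 * ∑ c', A c c' := by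
    calc |pairSum f N S| ≤ ∑ c, ∑ c', |H c * H c' * A c c'| :=
          (Finset.abs_sum_le_sum_abs _ _).trans
            (Finset.sum_le_sum fun c _ => Finset.abs_sum_le_sum_abs _ _)
      _ ≤ ∑ c, ∑ c', (H c ^ 2 / 2 * A c c' + H c' ^ 2 / 2 * A c' c) := by
          refine Finset.sum_le_sum fun c _ => Finset.sum_le_sum fun c' _ => ?_
          rw [hAs c' c, ← add_mul, abs_mul, abs_of_nonneg (hA0 c c')]
          refine mul_le_mul_of_nonneg_right ?_ (hA0 c c')
          rw [abs_mul]
          nlinarith [sq_nonneg (|H c| - |H c'|), sq_abs (H c), sq_abs (H c')]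
      _ = ∑ c, H c ^ 2 * ∑ c', A c c' := by
          simp only [Finset.sum_add_distrib]
          rw [Finset.sum_comm (f := fun c c' => H c' ^ 2 / 2 * A c' c), ← Finset.sum_add_distrib]
          refine Finset.sum_congr rfl fun c _ => ?_
          rw [← Finset.mul_sum]
          ring
  calc (N : ℝ) ^ S.card * |pairSum f N S|
      ≤ (N : ℝ) ^ S.card * ∑ c, H c ^ 2 * ∑ c', A c c' := by gcongr
    _ = ∑ c, (N : ℝ) ^ K * H c ^ 2 := by
        rw [Finset.mul_sum]
        refine Finset.sum_congr rfl fun c _ => ?_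
        rw [← mul_sum_prod_agree S c]
        ring
    _ ≤ ∑ c : Fin K → Fin N, ∫ z in box c, f z ^ 2 ∂(cube (Fin K)) :=
        Finset.sum_le_sum fun c _ => mul_sq_integral_box_le hf hN c
    _ = ∫ z, f z ^ 2 ∂(cube (Fin K)) := (integral_eq_sum_box hN hf.integrable_sq).symm

end Grid

/-! ### Uniform random permutations -/

instance (N : ℕ) : DiscreteMeasurableSpace (Equiv.Perm (Fin N)) := ⟨fun _ => trivial⟩

/-- The uniform distribution on the permutations of `{0, …, N-1}`. -/
abbrev unifPerm (N : ℕ) : Measure (Equiv.Perm (Fin N)) :=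
  (PMF.uniformOfFintype (Equiv.Perm (Fin N))).toMeasure

lemma card_fiber_mul_card {A B : Type*} [Fintype A] [DecidableEq B] (e : A → B) (S : Finset B)
    (hS : ∀ a, e a ∈ S)
    (heq : ∀ b ∈ S, ∀ b' ∈ S, (Finset.univ.filter fun a => e a = b).card =
      (Finset.univ.filter fun a => e a = b').card) {b : B} (hb : b ∈ S) :
    (Finset.univ.filter fun a => e a = b).card * S.card = Fintype.card A := by
  have h := Finset.card_eq_sum_card_fiberwise (s := Finset.univ) (f := e) (t := S) fun a _ => hS a
  rw [← Finset.card_univ, h, Finset.sum_congr rfl fun b' hb' => heq b' hb' b hb,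
    Finset.sum_const, smul_eq_mul, mul_comm]

/-- Left multiplication by `τ` is a bijection between fibres, so all fibres over `S` have equal size
and `e` is uniform on `S`. -/
lemma unifPerm_fiber {N : ℕ} {B : Type*} [DecidableEq B] (e : Equiv.Perm (Fin N) → B)
    (S : Finset B) (hS : ∀ σ, e σ ∈ S)
    (heq : ∀ b ∈ S, ∀ b' ∈ S, ∃ τ : Equiv.Perm (Fin N), ∀ σ, e σ = b ↔ e (τ * σ) = b')
    {b : B} (hb : b ∈ S) : unifPerm N {σ | e σ = b} = (S.card : ENNReal)⁻¹ := by
  have hcard := card_fiber_mul_card e S hS (fun b hb b' hb' => by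
    obtain ⟨τ, hτ⟩ := heq b hb b' hb'
    refine Finset.card_equiv (Equiv.mulLeft τ) fun σ => ?_
    simpa using hτ σ) hb
  rw [unifPerm, PMF.toMeasure_uniformOfFintype_apply _ (MeasurableSet.of_discrete), ← hcard]
  have h1 : Fintype.card {σ | e σ = b} = (Finset.univ.filter fun a => e a = b).card := by
    rw [Fintype.card_ofFinset]
    rfl
  have h2 : (Finset.univ.filter fun a => e a = b).card ≠ 0 := by
    intro h0
    rw [h0, zero_mul] at hcard
    exact Fintype.card_ne_zero hcard.symm
  have h3 : ((Finset.univ.filter fun a => e a = b).card : ENNReal) ≠ 0 := by exact_mod_cast h2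
  simp only [h1]
  rw [Nat.cast_mul, ENNReal.div_eq_inv_mul, ENNReal.mul_inv (.inl h3) (.inl (by simp)),
    mul_right_comm, ENNReal.inv_mul_cancel h3 (by simp), one_mul]

lemma unifPerm_eval {N : ℕ} (j a : Fin N) : unifPerm N {σ | σ j = a} = (N : ENNReal)⁻¹ := by
  have h := unifPerm_fiber (fun σ : Equiv.Perm (Fin N) => σ j) Finset.univ (by simp)
    (fun b _ b' _ => ⟨Equiv.swap b b', fun σ => by
      rw [Equiv.Perm.mul_apply, Equiv.swap_apply_eq_iff, Equiv.swap_apply_right]⟩)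
    (Finset.mem_univ a)
  simpa using h

lemma exists_perm_pair {N : ℕ} {a b a' b' : Fin N} (h : a ≠ b) (h' : a' ≠ b') :
    ∃ τ : Equiv.Perm (Fin N), τ a = a' ∧ τ b = b' := by
  refine ⟨Equiv.swap (Equiv.swap a a' b) b' * Equiv.swap a a', ?_, ?_⟩
  · rw [Equiv.Perm.mul_apply, Equiv.swap_apply_left]
    refine Equiv.swap_apply_of_ne_of_ne (fun h1 => h ?_) h'
    rw [eq_comm, Equiv.swap_apply_eq_iff, Equiv.swap_apply_right] at h1
    exact h1.symm
  · rw [Equiv.Perm.mul_apply, Equiv.swap_apply_left]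

/-- Double transitivity makes the pair uniform off the diagonal. The factor `1 - indicator` prepares
the expansion over subsets of coordinates. -/
lemma unifPerm_eval_pair {N : ℕ} {i j : Fin N} (hij : i ≠ j) (c : Fin N × Fin N) :
    (unifPerm N).real {σ | (σ i, σ j) = c} =
      ((N : ℝ) * (N - 1))⁻¹ * (1 - if c.1 = c.2 then 1 else 0) := by
  split_ifs with hc
  · have : {σ : Equiv.Perm (Fin N) | (σ i, σ j) = c} = ∅ := by
      refine eq_empty_of_forall_notMem fun σ hσ => hij (σ.injective ?_)
      have hσ' : (σ i, σ j) = c := hσ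
      rw [← hσ'] at hc
      exact hc
    simp [this]
  · have hN : 1 ≤ N := i.pos
    have h := unifPerm_fiber (fun σ : Equiv.Perm (Fin N) => (σ i, σ j)) Finset.univ.offDiag
      (fun σ => by simpa using fun h => hij (σ.injective h))
      (fun b hb b' hb' => by
        obtain ⟨τ, h1, h2⟩ := exists_perm_pair (by simpa using hb : b.1 ≠ b.2)
          (by simpa using hb' : b'.1 ≠ b'.2)
        refine ⟨τ, fun σ => ?_⟩
        simp only [Prod.ext_iff, Equiv.Perm.mul_apply, ← h1, ← h2, τ.injective.eq_iff])
      (b := c) (by simpa using hc)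
    rw [measureReal_def, h, Finset.offDiag_card, Finset.card_univ, Fintype.card_fin,
      ENNReal.toReal_inv, ENNReal.toReal_natCast, Nat.cast_sub (by nlinarith)]
    push_cast
    ring

/-! ### One and two points of a Latin hypercube sample -/

lemma lhsMeasure_eq (N K : ℕ) :
    lhsMeasure N K = (Measure.pi fun _ : Fin K => unifPerm N).prod
      (Measure.pi fun _ : Fin N => cube (Fin K)) := by
  simp only [cube_eq_pi]
  rfl

instance (N K : ℕ) : IsProbabilityMeasure (lhsMeasure N K) := by
  rw [lhsMeasure_eq]; infer_instance

lemma measurable_lhsPoint {N K : ℕ} (j : Fin N) :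
    Measurable fun ω : (Fin K → Equiv.Perm (Fin N)) × (Fin N → Fin K → ℝ) => lhsPoint ω j := by
  refine measurable_pi_lambda _ fun k => ?_
  have h1 : Measurable fun ω : (Fin K → Equiv.Perm (Fin N)) × (Fin N → Fin K → ℝ) =>
      (((ω.1 k j : Fin N) : ℕ) : ℝ) :=
    (measurable_of_countable fun σ : Equiv.Perm (Fin N) => (((σ j : Fin N) : ℕ) : ℝ)).comp
      ((measurable_pi_apply k).comp measurable_fst)
  have h2 : Measurable fun ω : (Fin K → Equiv.Perm (Fin N)) × (Fin N → Fin K → ℝ) =>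
      ω.2 j k := by fun_prop
  exact ((h1.add_const 1).sub h2).div_const _

lemma measurePreserving_pi_perm {N : ℕ} (K : ℕ) {B : Type*} [MeasurableSpace B]
    (e : Equiv.Perm (Fin N) → B) :
    MeasurePreserving (fun (p : Fin K → Equiv.Perm (Fin N)) k => e (p k))
      (Measure.pi fun _ : Fin K => unifPerm N)
      (Measure.pi fun _ : Fin K => (unifPerm N).map e) := by
  have he : Measurable e := .of_discrete
  have : IsProbabilityMeasure ((unifPerm N).map e) :=
    Measure.isProbabilityMeasure_map he.aemeasurable
  exact measurePreserving_pi _ _ fun _ => ⟨he, rfl⟩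

/-- Every point of a Latin hypercube sample is uniformly distributed on the cube. -/
theorem measurePreserving_lhsPoint {N K : ℕ} (j : Fin N) :
    MeasurePreserving (fun ω => lhsPoint ω j) (lhsMeasure N K) (cube (Fin K)) := by
  refine ⟨measurable_lhsPoint j, ?_⟩
  have he : Measurable fun σ : Equiv.Perm (Fin N) => σ j := .of_discrete
  have : IsProbabilityMeasure ((unifPerm N).map fun σ => σ j) :=
    Measure.isProbabilityMeasure_map he.aemeasurable
  have hN : (N : ENNReal) ≠ 0 := by exact_mod_cast j.pos.ne'
  ext s hs
  rw [Measure.map_apply (measurable_lhsPoint j) hs, lhsMeasure_eq,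
    Measure.prod_apply (measurable_lhsPoint j hs)]
  -- Given the permutations, the point is uniform in its box; the box itself is uniform among the `N
  -- ^ K` boxes.
  have h1 : ∀ p : Fin K → Equiv.Perm (Fin N),
      (Measure.pi fun _ : Fin N => cube (Fin K))
        (Prod.mk p ⁻¹' ((fun ω => lhsPoint ω j) ⁻¹' s)) =
      (N : ENNReal) ^ K * cube (Fin K) (s ∩ box fun k => p k j) := by
    intro p
    have hmp := measurePreserving_eval (fun _ : Fin N => cube (Fin K)) j
    have : (Prod.mk p ⁻¹' ((fun ω => lhsPoint ω j) ⁻¹' s)) =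
        Function.eval j ⁻¹' (gridPoint (fun k => p k j) ⁻¹' s) := rfl
    rw [this, hmp.measure_preimage (measurable_gridPoint _ hs).nullMeasurableSet,
      ← Measure.map_apply (measurable_gridPoint _) hs, map_gridPoint, Measure.smul_apply,
      Measure.restrict_apply hs, smul_eq_mul]
  simp only [h1]
  have hmp := measurePreserving_pi_perm K fun σ : Equiv.Perm (Fin N) => σ j
  rw [hmp.lintegral_comp (f := fun c => (N : ENNReal) ^ K * cube (Fin K) (s ∩ box c))
    (measurable_of_countable _), lintegral_fintype]
  have h2 : ∀ c : Fin K → Fin N,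
      (Measure.pi fun _ : Fin K => (unifPerm N).map fun σ => σ j) {c} =
        ((N : ENNReal) ^ K)⁻¹ := by
    intro c
    rw [Measure.pi_singleton]
    have : ∀ a : Fin N, ((unifPerm N).map fun σ => σ j) {a} = (N : ENNReal)⁻¹ := fun a => by
      rw [Measure.map_apply he (measurableSet_singleton a)]
      exact unifPerm_eval j a
    simp [this, ENNReal.inv_pow]
  have h3 : ∀ c : Fin K → Fin N, (N : ENNReal) ^ K * cube (Fin K) (s ∩ box c) *
      ((N : ENNReal) ^ K)⁻¹ = cube (Fin K) (s ∩ box c) := fun c => by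
    rw [mul_right_comm, ENNReal.mul_inv_cancel (pow_ne_zero _ hN) (by simp), one_mul]
  simp only [h2, h3]
  rw [← tsum_fintype (L := SummationFilter.unconditional _), ← measure_iUnion
    (fun c c' h => (pairwise_disjoint_box N K h).mono inter_subset_right inter_subset_right)
    (fun c => hs.inter (measurableSet_box c)), ← inter_iUnion]
  refine measure_congr ?_
  filter_upwards [ae_mem_iUnion_box (K := K) j.pos] with z hz
  have : (z ∈ s ∩ ⋃ c : Fin K → Fin N, box c) = (z ∈ s) := by
    simp only [mem_inter_iff, hz, and_true]
  exact this

section Pair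

variable {N K : ℕ} {f : (Fin K → ℝ) → ℝ}

lemma memLp_comp_lhsPoint (hf : MemLp f 2 (cube (Fin K))) (j : Fin N) :
    MemLp (fun ω => f (lhsPoint ω j)) 2 (lhsMeasure N K) :=
  hf.comp_measurePreserving (measurePreserving_lhsPoint j)

lemma integral_comp_lhsPoint {φ : (Fin K → ℝ) → ℝ} (hφ : AEStronglyMeasurable φ (cube (Fin K)))
    (j : Fin N) :
    ∫ ω, φ (lhsPoint ω j) ∂(lhsMeasure N K) = ∫ z, φ z ∂(cube (Fin K)) := by
  have hmp := measurePreserving_lhsPoint (K := K) j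
  rw [← hmp.map_eq, integral_map hmp.measurable.aemeasurable (by rwa [hmp.map_eq])]

lemma integral_gridPoint_mul_gridPoint (hf : MemLp f 2 (cube (Fin K))) {i j : Fin N} (hij : i ≠ j)
    (c c' : Fin K → Fin N) :
    ∫ u, f (gridPoint c (u i)) * f (gridPoint c' (u j))
        ∂(Measure.pi fun _ : Fin N => cube (Fin K)) =
      ((N : ℝ) ^ K * ∫ z in box c, f z ∂(cube (Fin K))) *
        ((N : ℝ) ^ K * ∫ z in box c', f z ∂(cube (Fin K))) := by
  have hm : ∀ (c : Fin K → Fin N) (l : Fin N), AEStronglyMeasurable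
      (fun u : Fin N → Fin K → ℝ => f (gridPoint c (u l)))
      (Measure.pi fun _ : Fin N => cube (Fin K)) := fun c l =>
    (memLp_comp_gridPoint hf c).aestronglyMeasurable.comp_measurePreserving
      (measurePreserving_eval (fun _ : Fin N => cube (Fin K)) l)
  have hI : ∀ (c : Fin K → Fin N) (l : Fin N),
      ∫ u, f (gridPoint c (u l)) ∂(Measure.pi fun _ : Fin N => cube (Fin K)) =
        (N : ℝ) ^ K * ∫ z in box c, f z ∂(cube (Fin K)) := fun c l => by
    rw [← integral_comp_gridPoint hf.aestronglyMeasurable]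
    exact MeasureTheory.integral_comp_eval (μ := fun _ : Fin N => cube (Fin K)) (i := l)
      (f := fun u => f (gridPoint c u)) (memLp_comp_gridPoint hf c).aestronglyMeasurable
  have hind : IndepFun (fun u : Fin N → Fin K → ℝ => f (gridPoint c (u i)))
      (fun u => f (gridPoint c' (u j))) (Measure.pi fun _ : Fin N => cube (Fin K)) := by
    -- Independence is stated for a family over all rows, so `c` is used at row `i` and `c'` at
    -- every other row.
    have := (iIndepFun_pi (X := fun (l : Fin N) u => if l = i then f (gridPoint c u)
      else f (gridPoint c' u)) (μ := fun _ : Fin N => cube (Fin K)) fun l => by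
        split_ifs
        · exact (memLp_comp_gridPoint hf c).aestronglyMeasurable.aemeasurable
        · exact (memLp_comp_gridPoint hf c').aestronglyMeasurable.aemeasurable).indepFun hij
    simpa [hij.symm] using this
  rw [hind.integral_fun_mul_eq_mul_integral (hm c i) (hm c' j), hI, hI]

/-- The mixed second moment of two points of a Latin hypercube sample. -/
theorem integral_lhsPoint_mul_lhsPoint (hf : MemLp f 2 (cube (Fin K))) {i j : Fin N}
    (hij : i ≠ j) :
    ∫ ω, f (lhsPoint ω i) * f (lhsPoint ω j) ∂(lhsMeasure N K) =
      ((N : ℝ) / (N - 1)) ^ K * ∑ S : Finset (Fin K), (-1) ^ S.card * pairSum f N S := by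
  set H : (Fin K → Fin N) → ℝ := fun c => ∫ z in box c, f z ∂(cube (Fin K)) with hH
  have hint : Integrable (fun ω => f (lhsPoint ω i) * f (lhsPoint ω j)) (lhsMeasure N K) :=
    (memLp_comp_lhsPoint hf i).integrable_mul (memLp_comp_lhsPoint hf j)
  let e : Equiv.Perm (Fin N) → Fin N × Fin N := fun σ => (σ i, σ j)
  have he : Measurable e := .of_discrete
  have : IsProbabilityMeasure ((unifPerm N).map e) :=
    Measure.isProbabilityMeasure_map he.aemeasurable
  have hmp := measurePreserving_pi_perm K e
  have h1 : ∫ ω, f (lhsPoint ω i) * f (lhsPoint ω j) ∂(lhsMeasure N K) =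
      ∫ c : Fin K → Fin N × Fin N,
        ((N : ℝ) ^ K * H fun k => (c k).1) * ((N : ℝ) ^ K * H fun k => (c k).2)
        ∂(Measure.pi fun _ : Fin K => (unifPerm N).map e) := by
    rw [lhsMeasure_eq] at hint ⊢
    rw [integral_prod _ hint, ← hmp.map_eq,
      integral_map hmp.measurable.aemeasurable (.of_discrete)]
    exact integral_congr_ae (.of_forall fun p =>
      integral_gridPoint_mul_gridPoint hf hij (fun k => p k i) fun k => p k j)
  have hN1 : (N : ℝ) ≠ 0 := by exact_mod_cast i.pos.ne'
  -- The product over coordinates of `1 - 1{c.1 = c.2}` is expanded by inclusion–exclusion.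
  have h2 : ∀ c : Fin K → Fin N × Fin N,
      (Measure.pi fun _ : Fin K => (unifPerm N).map e).real {c} =
        (((N : ℝ) * (N - 1))⁻¹) ^ K *
          ∑ S : Finset (Fin K), (-1) ^ S.card * ∏ k ∈ S, if (c k).1 = (c k).2 then 1 else 0 := by
    intro c
    have h3 : ∀ a, ((unifPerm N).map e).real {a} =
        ((N : ℝ) * (N - 1))⁻¹ * (1 - if a.1 = a.2 then 1 else 0) := fun a => by
      rw [map_measureReal_apply he (measurableSet_singleton a)]
      exact unifPerm_eval_pair hij a
    rw [measureReal_def, Measure.pi_singleton, ENNReal.toReal_prod]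
    simp only [← measureReal_def, h3]
    rw [Finset.prod_mul_distrib, Finset.prod_const, Finset.card_univ, Fintype.card_fin,
      Finset.prod_sub]
    simp
  rw [h1, integral_fintype (.of_finite)]
  simp only [h2, smul_eq_mul]
  rw [← (Equiv.arrowProdEquivProdArrow (Fin K) (fun _ => Fin N) (fun _ => Fin N)).symm.sum_comp,
    Fintype.sum_prod_type]
  have h4 : (((N : ℝ) * (N - 1))⁻¹) ^ K * ((N : ℝ) ^ K * (N : ℝ) ^ K) =
      ((N : ℝ) / (N - 1)) ^ K := by
    rw [← mul_pow, ← mul_pow]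
    congr 1
    rw [mul_inv]
    field_simp
  simp only [pairSum, Finset.mul_sum]
  rw [Finset.sum_comm (s := (Finset.univ : Finset (Finset (Fin K))))]
  refine Finset.sum_congr rfl fun c _ => ?_
  rw [Finset.sum_comm (s := (Finset.univ : Finset (Finset (Fin K))))]
  refine Finset.sum_congr rfl fun c' _ => ?_
  rw [Finset.sum_mul]
  refine Finset.sum_congr rfl fun S _ => ?_
  rw [← h4]
  change (((N : ℝ) * (N - 1))⁻¹) ^ K *
      ((-1) ^ S.card * ∏ k ∈ S, if c k = c' k then (1 : ℝ) else 0) *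
      (((N : ℝ) ^ K * H c) * ((N : ℝ) ^ K * H c')) = _ * ((-1) ^ S.card *
      (H c * H c' * ∏ k ∈ S, if c k = c' k then (1 : ℝ) else 0))
  ring

end Pair

/-! ### The asymptotic variance -/

lemma memLp_sampleMean {α : Type*} [MeasurableSpace α] {μ : Measure α} {N K : ℕ}
    {g : (Fin K → ℝ) → ℝ} {x : α → Fin N → Fin K → ℝ} (h : ∀ j, MemLp (fun ω => g (x ω j)) 2 μ) :
    MemLp (fun ω => sampleMean g (x ω)) 2 μ := by
  have h1 : MemLp (fun ω => ∑ j, g (x ω j)) 2 μ := memLp_finsetSum _ fun j _ => h j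
  simpa only [sampleMean, div_eq_inv_mul] using h1.const_mul (N : ℝ)⁻¹

section Variance

variable {K : ℕ} {f : (Fin K → ℝ) → ℝ}

/-- The variance of the mean of a centred function over a Latin hypercube sample. -/
lemma mul_variance_lhs (hf : MemLp f 2 (cube (Fin K))) (h0 : ∫ z, f z ∂(cube (Fin K)) = 0)
    {N : ℕ} (hN : 2 ≤ N) :
    N * variance (fun ω => sampleMean f (lhsPoint (N := N) ω)) (lhsMeasure N K) =
      ∫ z, f z ^ 2 ∂(cube (Fin K)) + ((N : ℝ) - 1) / N * ((N : ℝ) / (N - 1)) ^ K *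
        ∑ S : Finset (Fin K), (-1) ^ S.card * (N * pairSum f N S) := by
  have hN0 : (N : ℝ) ≠ 0 := by positivity
  have hL := memLp_comp_lhsPoint (N := N) hf
  have hmean : ∫ ω, sampleMean f (lhsPoint (N := N) ω) ∂(lhsMeasure N K) = 0 := by
    simp only [sampleMean]
    rw [integral_div, integral_finsetSum _ fun j _ => (hL j).integrable one_le_two]
    simp [integral_comp_lhsPoint hf.aestronglyMeasurable, h0]
  rw [variance_of_integral_eq_zero (memLp_sampleMean hL).aestronglyMeasurable.aemeasurable hmean]
  set B := ((N : ℝ) / (N - 1)) ^ K * ∑ S : Finset (Fin K), (-1) ^ S.card * pairSum f N S with hB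
  set A := ∫ z, f z ^ 2 ∂(cube (Fin K)) with hA
  have hexp : ∀ ω : (Fin K → Equiv.Perm (Fin N)) × (Fin N → Fin K → ℝ),
      sampleMean f (lhsPoint ω) ^ 2 =
        (∑ i, ∑ j, f (lhsPoint ω i) * f (lhsPoint ω j)) / (N : ℝ) ^ 2 := fun ω => by
    rw [sampleMean, div_pow, sq (∑ j, f (lhsPoint ω j)), Finset.sum_mul_sum]
  -- Diagonal terms equal `A`, all others `B`; writing this as `B` plus a diagonal correction makes
  -- the double sum immediate.
  have hij : ∀ i j : Fin N, ∫ ω, f (lhsPoint ω i) * f (lhsPoint ω j) ∂(lhsMeasure N K) =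
      (if i = j then A - B else 0) + B := by
    intro i j
    split_ifs with h
    · subst h
      simp only [← sq, sub_add_cancel]
      exact integral_comp_lhsPoint (hf.aestronglyMeasurable.pow 2) i
    · rw [zero_add]
      exact integral_lhsPoint_mul_lhsPoint hf h
  have hint : ∀ i j : Fin N,
      Integrable (fun ω => f (lhsPoint ω i) * f (lhsPoint ω j)) (lhsMeasure N K) :=
    fun i j => (hL i).integrable_mul (hL j)
  simp only [hexp]
  rw [integral_div, integral_finsetSum _ fun i _ => integrable_finsetSum _ fun j _ => hint i j]
  have hsum : ∀ i : Fin N, ∫ ω, ∑ j, f (lhsPoint ω i) * f (lhsPoint ω j) ∂(lhsMeasure N K) =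
      A - B + N * B := fun i => by
    rw [integral_finsetSum _ fun j _ => hint i j]
    simp [hij, Finset.sum_add_distrib]
  simp only [hsum, Finset.sum_const, Finset.card_univ, Fintype.card_fin, nsmul_eq_mul]
  have hC : ∑ S : Finset (Fin K), (-1) ^ S.card * (N * pairSum f N S) =
      N * ∑ S : Finset (Fin K), (-1) ^ S.card * pairSum f N S := by
    rw [Finset.mul_sum]
    exact Finset.sum_congr rfl fun S _ => by ring
  have hD : ((N : ℝ) - 1) / N * ((N : ℝ) / (N - 1)) ^ K *
      (N * ∑ S : Finset (Fin K), (-1) ^ S.card * pairSum f N S) = (N - 1) * B := by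
    rw [hB]
    field_simp
  rw [hC, hD]
  field_simp
  ring

/-- The limit is nonzero only for singletons: the empty set vanishes by centring, and `|S| ≥ 2`
leaves a factor `1 / N`. -/
lemma tendsto_mul_pairSum (hf : MemLp f 2 (cube (Fin K))) (h0 : ∫ z, f z ∂(cube (Fin K)) = 0)
    (S : Finset (Fin K)) :
    Tendsto (fun N : ℕ => (N : ℝ) * pairSum f N S) atTop
      (nhds (∑ k, if S = {k} then ∫ t, margin f k t ^ 2 ∂unif else 0)) := by
  rcases Nat.lt_or_ge 1 S.card with h | h
  · have hne : ∀ k, S ≠ {k} := fun k hk => by simp [hk] at h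
    simp only [hne, if_false, Finset.sum_const_zero]
    set A := ∫ z, f z ^ 2 ∂(cube (Fin K)) with hA
    have hlim : Tendsto (fun N : ℕ => A * (1 / (N : ℝ))) atTop (nhds 0) := by
      simpa using (tendsto_one_div_atTop_nhds_zero_nat (𝕜 := ℝ)).const_mul A
    refine squeeze_zero_norm' ?_ hlim
    filter_upwards [eventually_ge_atTop 1] with N hN
    have hNr : (1 : ℝ) ≤ N := by exact_mod_cast hN
    have h1 := abs_pairSum_le hf (show 0 < N by omega) S
    have h2 : (N : ℝ) ^ 2 * |pairSum f N S| ≤ A :=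
      (mul_le_mul_of_nonneg_right (pow_le_pow_right₀ hNr h) (abs_nonneg _)).trans h1
    rw [Real.norm_eq_abs, abs_mul, Nat.abs_cast, mul_one_div, le_div_iff₀ (by linarith)]
    linarith
  · rcases S.eq_empty_or_nonempty with rfl | hS'
    · have hne : ∀ k : Fin K, (∅ : Finset (Fin K)) ≠ {k} := fun k =>
        (Finset.singleton_ne_empty k).symm
      simp only [hne, if_false, Finset.sum_const_zero]
      refine tendsto_const_nhds.congr' ?_
      filter_upwards [eventually_ge_atTop 1] with N hN
      rw [pairSum_empty hf (by omega), h0]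
      simp
    · obtain ⟨k, rfl⟩ := Finset.card_eq_one.1 (le_antisymm h hS'.card_pos)
      simp only [Finset.singleton_inj, Finset.sum_ite_eq, Finset.mem_univ, if_true,
        pairSum_singleton hf]
      exact tendsto_sum_sq_integral_cell (memLp_margin hf k)

/-- The asymptotic variance of the mean of a centred function over a Latin hypercube sample. -/
theorem tendsto_mul_variance_lhs (hf : MemLp f 2 (cube (Fin K)))
    (h0 : ∫ z, f z ∂(cube (Fin K)) = 0) :
    Tendsto (fun N : ℕ =>
      N * variance (fun ω => sampleMean f (lhsPoint (N := N) ω)) (lhsMeasure N K)) atTop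
      (nhds (∫ z, (f z - ∑ k, margin f k (z k)) ^ 2 ∂(cube (Fin K)))) := by
  have hr : Tendsto (fun N : ℕ => ((N : ℝ) - 1) / N) atTop (nhds 1) := by
    have h1 : Tendsto (fun N : ℕ => 1 - 1 / (N : ℝ)) atTop (nhds (1 - 0)) :=
      tendsto_const_nhds.sub tendsto_one_div_atTop_nhds_zero_nat
    rw [sub_zero] at h1
    refine h1.congr' ?_
    filter_upwards [eventually_ge_atTop 1] with N hN
    have : (N : ℝ) ≠ 0 := by positivity
    field_simp
  have hr' : Tendsto (fun N : ℕ => (N : ℝ) / (N - 1)) atTop (nhds 1) := by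
    simpa using hr.inv₀ one_ne_zero
  have hS := tendsto_finsetSum (Finset.univ : Finset (Finset (Fin K))) fun S _ =>
    (tendsto_mul_pairSum hf h0 S).const_mul ((-1) ^ S.card)
  have hlim := ((hr.mul (hr'.pow K)).mul hS).const_add (∫ z, f z ^ 2 ∂(cube (Fin K)))
  -- Only singletons survive, each with sign `-1`.
  have hval : ∫ z, f z ^ 2 ∂(cube (Fin K)) + 1 * 1 ^ K * ∑ S : Finset (Fin K),
      (-1) ^ S.card * ∑ k, (if S = {k} then ∫ t, margin f k t ^ 2 ∂unif else 0) =
      ∫ z, (f z - ∑ k, margin f k (z k)) ^ 2 ∂(cube (Fin K)) := by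
    rw [integral_sq_sub_sum_margin hf h0, one_pow, one_mul, one_mul, sub_eq_add_neg]
    congr 1
    simp only [Finset.mul_sum]
    rw [Finset.sum_comm, ← Finset.sum_neg_distrib]
    refine Finset.sum_congr rfl fun k _ => ?_
    simp
  rw [hval] at hlim
  refine hlim.congr' ?_
  filter_upwards [eventually_ge_atTop 2] with N hN
  exact (mul_variance_lhs hf h0 hN).symm

end Variance

lemma sampleMean_sub {N K : ℕ} (hN : 0 < N) (g : (Fin K → ℝ) → ℝ) (τ : ℝ)
    (x : Fin N → Fin K → ℝ) : sampleMean (fun z => g z - τ) x = sampleMean g x - τ := by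
  have : (N : ℝ) ≠ 0 := by positivity
  simp only [sampleMean, Finset.sum_sub_distrib, Finset.sum_const, Finset.card_univ,
    Fintype.card_fin, nsmul_eq_mul]
  field_simp

lemma memLp_comp_srs {K : ℕ} {μ : Measure (Fin K → ℝ)} [IsProbabilityMeasure μ]
    {h : (Fin K → ℝ) → ℝ} (hh : MemLp h 2 μ) {N : ℕ} (j : Fin N) :
    MemLp (fun x : Fin N → Fin K → ℝ => h (x j)) 2 (srsMeasure μ N) :=
  hh.comp_measurePreserving (measurePreserving_eval (fun _ : Fin N => μ) j)

lemma variance_srs {K : ℕ} {μ : Measure (Fin K → ℝ)} [IsProbabilityMeasure μ]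
    {h : (Fin K → ℝ) → ℝ} (hh : MemLp h 2 μ) {N : ℕ} (hN : 0 < N) :
    variance (sampleMean (N := N) h) (srsMeasure μ N) = 1 / N * variance h μ := by
  have hN0 : (N : ℝ) ≠ 0 := by positivity
  have h1 : sampleMean (N := N) h = fun x => (N : ℝ)⁻¹ * (∑ j : Fin N, fun x => h (x j)) x := by
    funext x
    simp [sampleMean, div_eq_inv_mul]
  rw [h1, variance_const_mul, srsMeasure, variance_sum_pi fun _ => hh]
  simp
  field_simp

end LHSD

end

/-! ### Transfer from the uniform cube back to the dependent inputs -/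

theorem theorem1 {Ω : Type*} [MeasurableSpace Ω] (P : Measure Ω) [IsProbabilityMeasure P]
    {K : ℕ} (X : Ω → Fin K → ℝ) (hX : AEMeasurable X P)
    (Q : (k : Fin K) → Kernel (Fin (k : ℕ) → ℝ) ℝ) [∀ k, IsMarkovKernel (Q k)]
    (hQ : ∀ k, HasCondDistrib (fun ω => X ω k) (fun ω => LHSD.prefixOf (X ω) k) (Q k) P)
    (h : (Fin K → ℝ) → ℝ) (hh : Measurable h) (h2 : MemLp (fun ω => h (X ω)) 2 P)
    (τ : ℝ) (hτ : τ = ∫ ω, h (X ω) ∂P) :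
    -- all the second moments below are finite
    MemLp (LHSD.hStar Q h) 2 (LHSD.cube (Fin K)) ∧
    (∀ k, MemLp (LHSD.mainEffect (LHSD.hStar Q h) τ k) 2 (volume.restrict (Icc 0 1))) ∧
    MemLp (LHSD.residual (LHSD.hStar Q h) τ) 2 (LHSD.cube (Fin K)) ∧
    (∀ N, MemLp (LHSD.lhsdEstimator Q h N) 2 (LHSD.lhsMeasure N K)) ∧
    (∀ N, MemLp (LHSD.sampleMean h) 2 (LHSD.srsMeasure (P.map X) N)) ∧
    -- the variance under Latin hypercube sampling for dependent inputs
    (fun N : ℕ => variance (LHSD.lhsdEstimator Q h N) (LHSD.lhsMeasure N K)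
        - 1 / (N : ℝ) * ∫ z, LHSD.residual (LHSD.hStar Q h) τ z ^ 2 ∂(LHSD.cube (Fin K)))
      =o[atTop] (fun N : ℕ => 1 / (N : ℝ)) ∧
    -- the comparison with simple random sampling
    (fun N : ℕ => variance (LHSD.sampleMean h) (LHSD.srsMeasure (P.map X) N)
        - variance (LHSD.lhsdEstimator Q h N) (LHSD.lhsMeasure N K)
        - 1 / (N : ℝ) * ∑ k : Fin K,
            ∫ t in Icc (0 : ℝ) 1, LHSD.mainEffect (LHSD.hStar Q h) τ k t ^ 2)
      =o[atTop] (fun N : ℕ => 1 / (N : ℝ)) := by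
  have hlaw := LHSD.hasLaw_invRosenblatt P X hX Q hQ
  have : IsProbabilityMeasure (P.map X) := Measure.isProbabilityMeasure_map hX
  have hμ : MemLp h 2 (P.map X) :=
    (memLp_map_measure_iff hh.aestronglyMeasurable hX).2 h2
  have hg : MemLp (LHSD.hStar Q h) 2 (LHSD.cube (Fin K)) := by
    rw [← hlaw.map_eq] at hμ
    exact hμ.comp_of_map hlaw.aemeasurable
  have hgτ : ∫ z, LHSD.hStar Q h z ∂(LHSD.cube (Fin K)) = τ := by
    rw [hτ, ← integral_map hX hh.aestronglyMeasurable, ← hlaw.map_eq,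
      integral_map hlaw.aemeasurable hh.aestronglyMeasurable]
    rfl
  have hf : MemLp (fun z => LHSD.hStar Q h z - τ) 2 (LHSD.cube (Fin K)) :=
    hg.sub (memLp_const τ)
  have h0 : ∫ z, (LHSD.hStar Q h z - τ) ∂(LHSD.cube (Fin K)) = 0 := by
    rw [integral_sub (hg.integrable one_le_two) (integrable_const τ), hgτ]
    simp
  have hest : ∀ N, MemLp (LHSD.lhsdEstimator Q h N) 2 (LHSD.lhsMeasure N K) := fun N =>
    LHSD.memLp_sampleMean (LHSD.memLp_comp_lhsPoint hg)
  have hvar : ∀ N, 0 < N → variance (LHSD.lhsdEstimator Q h N) (LHSD.lhsMeasure N K) =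
      variance (fun ω => LHSD.sampleMean (fun z => LHSD.hStar Q h z - τ)
        (LHSD.lhsPoint (N := N) ω)) (LHSD.lhsMeasure N K) := fun N hN => by
    simp only [LHSD.sampleMean_sub hN]
    exact (variance_sub_const (hest N).aestronglyMeasurable τ).symm
  have hlhs : (fun N : ℕ => variance (LHSD.lhsdEstimator Q h N) (LHSD.lhsMeasure N K)
        - 1 / (N : ℝ) * ∫ z, LHSD.residual (LHSD.hStar Q h) τ z ^ 2 ∂(LHSD.cube (Fin K)))
      =o[atTop] (fun N : ℕ => 1 / (N : ℝ)) := by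
    -- Dividing by `1 / N` turns the claim into convergence of `N * Var` to `∫ r²`.
    refine (isLittleO_iff_tendsto' ?_).2 ?_
    · filter_upwards [eventually_ge_atTop 1] with N hN h1
      have : (N : ℝ) ≠ 0 := by positivity
      simp [this] at h1
    · have hlim := (LHSD.tendsto_mul_variance_lhs hf h0).sub_const
        (∫ z, LHSD.residual (LHSD.hStar Q h) τ z ^ 2 ∂(LHSD.cube (Fin K)))
      -- Main effects are by definition the margins of the centred function.
      have hres : ∫ z, ((LHSD.hStar Q h z - τ) -
          ∑ k, LHSD.margin (fun z => LHSD.hStar Q h z - τ) k (z k)) ^ 2 ∂(LHSD.cube (Fin K)) =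
          ∫ z, LHSD.residual (LHSD.hStar Q h) τ z ^ 2 ∂(LHSD.cube (Fin K)) := rfl
      rw [hres, sub_self] at hlim
      refine hlim.congr' ?_
      filter_upwards [eventually_ge_atTop 1] with N hN
      have : (N : ℝ) ≠ 0 := by positivity
      rw [hvar N hN]
      field_simp
  refine ⟨hg, LHSD.memLp_margin hf, LHSD.memLp_sub_sum_margin hf, hest,
    fun N => LHSD.memLp_sampleMean (LHSD.memLp_comp_srs hμ), hlhs, ?_⟩
  -- For `N ≥ 1` the SRS variance is exactly `(1 / N) * ∫ f²`, and `∫ f² = ∫ r² + ∑ ∫ α_k²`, so this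
  -- remainder is the negative of the previous one.
  refine hlhs.neg_left.congr' ?_ .rfl
  filter_upwards [eventually_ge_atTop 1] with N hN
  have hsrs : variance h (P.map X) =
      ∫ z, (LHSD.hStar Q h z - τ) ^ 2 ∂(LHSD.cube (Fin K)) := by
    rw [← hlaw.map_eq, variance_map hh.aemeasurable hlaw.aemeasurable]
    have h1 := variance_eq_integral hg.aestronglyMeasurable.aemeasurable
    rw [hgτ] at h1
    exact h1
  have hres := LHSD.integral_sq_sub_sum_margin hf h0
  rw [LHSD.variance_srs hμ hN, hsrs]
  change -(_ - 1 / (N : ℝ) * ∫ z, ((LHSD.hStar Q h z - τ) -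
    ∑ k, LHSD.margin (fun z => LHSD.hStar Q h z - τ) k (z k)) ^ 2 ∂(LHSD.cube (Fin K))) =
    _ - _ - 1 / (N : ℝ) * ∑ k, ∫ t,
      LHSD.margin (fun z => LHSD.hStar Q h z - τ) k t ^ 2 ∂LHSD.unif
  rw [hres]
  ring
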